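/- Let $m\ge 3$ and let $Q^m=\{[z]\in\mathbb{C}P^{m+1} : z_1^2+\cdots+z_{m+2}^2=0\}$ be the complex quadric, with the complex structure $J$ and the Riemannian metric $g$ induced from the Fubini--Study metric of constant holomorphic sectional curvature $4$; let $\bar R$ be its curvature tensor. For $[z]\in Q^m$ let $\mathfrak A_{[z]}$ be the set of shape operators $A=A_\rho$ of $Q^m\subset\mathbb{C}P^{m+1}$ at $[z]$ with respect to unit normal vectors $\rho$ (these are complex conjugations of $T_{[z]}Q^m$), and let $V(A)=\{X\in T_{[z]}Q^m : AX=X\}$. A nonzero tangent vector $W\in T_{[z]}Q^m$ is called $\mathfrak A$-isotropic (it is then singular) if there are $A\in\mathfrak A_{[z]}$ and orthonormal $Z_1,Z_2\in V(A)$ with $W/\|W\|=(Z_1+JZ_2)/\sqrt2$. Let $M$ be a real hypersurface in $Q^m$, that is, a smooth manifold of dimension $2m-1$ immersed in $Q^m$, with (local) unit normal vector field $N$, Reeb vector field $\xi=-JN$, shape operator $S$, Levi-Civita connection $\nabla$ of the induced metric, and normal Jacobi operator $\bar R_N Y=\bar R(Y,N)N$ on $TM$. Assume that $M$ is Hopf,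 i.e. $S\xi=\alpha\xi$ for a function $\alpha$ on $M$. Then $N$ is $\mathfrak A$-isotropic at every point of $M$ if and only if the normal Jacobi operator of $M$ is Reeb parallel, i.e. $(\nabla_\xi\bar R_N)Y=0$ for every tangent vector field $Y$ of $M$. -/

import Mathlib

open scoped Matrix Manifold ContDiff Matrix.Norms.L2Operator

noncomputable section

namespace ComplexQuadric

/-! ### Complex projective space and the complex quadric

A point `[z]` of `ℂP^{m+1}`, with `z ∈ ℂ^{m+2}` a unit vector, is represented by the orthogonal
projection `z z*` onto the complex line `ℂ z`.  This embeds `ℂP^{m+1}` as a submanifold of the real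
vector space of complex matrices, and the tangent vector at `[z]` with horizontal lift `v ⟂ ℂ z`
becomes the matrix `v z* + z v*`. -/

/-- The ambient space of complex matrices of size `m + 2`. -/
abbrev Mat (m : ℕ) : Type := Matrix (Fin (m + 2)) (Fin (m + 2)) ℂ

/-- The point `[z]`, as the orthogonal projection onto `ℂ z` (for a unit vector `z`). -/
def point {m : ℕ} (z : Fin (m + 2) → ℂ) : Mat m := Matrix.vecMulVec z (star z)

/-- The differential of `z ↦ [z]`: the tangent vector at `[z]` with horizontal lift `v`. -/
def tangentVec {m : ℕ} (z v : Fin (m + 2) → ℂ) : Mat m :=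
  Matrix.vecMulVec v (star z) + Matrix.vecMulVec z (star v)

/-- `z` is a unit vector. -/
def IsUnitVec {m : ℕ} (z : Fin (m + 2) → ℂ) : Prop := star z ⬝ᵥ z = 1

/-- `z` satisfies the equation `z₁² + ⋯ + z_{m+2}² = 0`. -/
def OnQuadric {m : ℕ} (z : Fin (m + 2) → ℂ) : Prop := ∑ i, z i ^ 2 = 0

/-- The complex quadric `Q^m` in `ℂP^{m+1}`. -/
def quadric (m : ℕ) : Set (Mat m) := {P | ∃ z, IsUnitVec z ∧ OnQuadric z ∧ P = point z}

/-- The tangent space of `ℂP^{m+1}` at `P = [z]`, identified with `ℂ^{m+2} ⊖ ℂ z`. -/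
def tangentCP {m : ℕ} (P : Mat m) : Set (Mat m) :=
  {X | ∃ z v, IsUnitVec z ∧ P = point z ∧ star z ⬝ᵥ v = 0 ∧ X = tangentVec z v}

/-- The tangent space of `Q^m` at `P = [z]`, identified with `ℂ^{m+2} ⊖ (ℂ z ⊕ ℂ z̄)`. -/
def tangentQ {m : ℕ} (P : Mat m) : Set (Mat m) :=
  {X | ∃ z v, IsUnitVec z ∧ OnQuadric z ∧ P = point z ∧
    star z ⬝ᵥ v = 0 ∧ z ⬝ᵥ v = 0 ∧ X = tangentVec z v}

/-- The metric: on tangent vectors it is the Fubini-Study metric of constant holomorphic sectional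
curvature `4`, i.e. the real part of the Hermitian product of horizontal lifts
(see `metric_tangentVec`). -/
def metric {m : ℕ} (X Y : Mat m) : ℝ := (1 / 2) * (Matrix.trace (X * Y)).re

/-- The complex structure `J` at `P`; it multiplies horizontal lifts by `i`
(see `cplx_tangentVec`). -/
def cplx {m : ℕ} (P X : Mat m) : Mat m := Complex.I • (X * P - P * X)

/-- The orthogonal projection onto the tangent space of `ℂP^{m+1}` at `P`. -/
def projCP {m : ℕ} (P X : Mat m) : Mat m := (1 - P) * X * P + P * X * (1 - P)

/-- The orthogonal projection onto the tangent space of `Q^m` at `P`; note that `Pᵀ` is the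
projection onto `ℂ z̄` if `P = [z]`.  See `projQ_of_mem`, `projQ_mem` and
`metric_sub_projQ`. -/
def projQ {m : ℕ} (P X : Mat m) : Mat m := (1 - P - Pᵀ) * X * P + P * X * (1 - P - Pᵀ)

/-- The orthogonal projection onto the normal space of `Q^m` in `ℂP^{m+1}` at `P`. -/
def projNormal {m : ℕ} (P X : Mat m) : Mat m := projCP P X - projQ P X

/-- The unit normal vectors of `Q^m` in `ℂP^{m+1}` at `P`. -/
def unitNormalQ {m : ℕ} (P : Mat m) : Set (Mat m) :=
  {ρ | ρ ∈ tangentCP P ∧ (∀ X ∈ tangentQ P, metric ρ X = 0) ∧ metric ρ ρ = 1}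

/-- The shape operator `A_ρ` of `Q^m` in `ℂP^{m+1}` at `P` with respect to the normal vector `ρ`:
minus the tangential part of the derivative of the normal field `P' ↦ projNormal P' ρ`
extending `ρ`. -/
def shapeQ {m : ℕ} (P ρ X : Mat m) : Mat m :=
  -projQ P (fderiv ℝ (fun P' : Mat m => projNormal P' ρ) P X)

/-- The tangent vector `W` of `Q^m` at `P` is `𝔄`-isotropic: it is nonzero and there are a
conjugation `A = A_ρ` in `𝔄_P` and orthonormal `Z₁, Z₂ ∈ V(A)` with
`W / ‖W‖ = (Z₁ + J Z₂) / √2`. -/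
def IsIsotropic {m : ℕ} (P W : Mat m) : Prop :=
  W ∈ tangentQ P ∧ W ≠ 0 ∧ ∃ ρ ∈ unitNormalQ P, ∃ Z₁ ∈ tangentQ P, ∃ Z₂ ∈ tangentQ P,
    shapeQ P ρ Z₁ = Z₁ ∧ shapeQ P ρ Z₂ = Z₂ ∧
    metric Z₁ Z₁ = 1 ∧ metric Z₂ Z₂ = 1 ∧ metric Z₁ Z₂ = 0 ∧
    (Real.sqrt (metric W W))⁻¹ • W = (Real.sqrt 2)⁻¹ • (Z₁ + cplx P Z₂)

/-! ### Levi-Civita connection and curvature of the quadric -/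

/-- The Levi-Civita connection of `Q^m`: `∇_X Y` is the tangential part of the derivative of `Y` in
the direction `X`, for vector fields that are tangent to `Q^m` along `Q^m`. -/
def nablaQ {m : ℕ} (X Y : Mat m → Mat m) (P : Mat m) : Mat m :=
  projQ P (fderiv ℝ Y P (X P))

/-- The Riemannian curvature of `Q^m` on vector fields,
`R(X, Y) Z = ∇_X ∇_Y Z - ∇_Y ∇_X Z - ∇_{[X, Y]} Z`. -/
def curvatureField {m : ℕ} (X Y Z : Mat m → Mat m) (P : Mat m) : Mat m :=
  nablaQ X (nablaQ Y Z) P - nablaQ Y (nablaQ X Z) P - nablaQ (VectorField.lieBracket ℝ X Y) Z P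

/-- The Riemannian curvature tensor of `Q^m` at `P`: tangent vectors `u` are extended to the
vector fields `P' ↦ projQ P' u`. -/
def curvature {m : ℕ} (P u v w : Mat m) : Mat m :=
  curvatureField (fun P' => projQ P' u) (fun P' => projQ P' v) (fun P' => projQ P' w) P

/-- The Jacobi operator `R_Z Y = R(Y, Z) Z` of `Q^m` at `P`. -/
def jacobi {m : ℕ} (P Z Y : Mat m) : Mat m := curvature P Y Z Z

/-! ### Real hypersurfaces -/

/-- The manifold `M` of dimension `2m - 1` is a real hypersurface of `Q^m` through the smooth
immersion `f`. -/
structure IsRealHypersurface {m : ℕ} {M : Type*} [TopologicalSpace M]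
    [ChartedSpace (EuclideanSpace ℝ (Fin (2 * m - 1))) M] (f : M → Mat m) : Prop where
  smooth : ContMDiff (𝓡 (2 * m - 1)) 𝓘(ℝ, Mat m) ∞ f
  mem : ∀ x, f x ∈ quadric m
  immersion : ∀ x, Function.Injective (mfderiv (𝓡 (2 * m - 1)) 𝓘(ℝ, Mat m) f x)

/-- The derivative at `x` of a map `Y : M → Mat m` in the direction `u ∈ T_x M`. -/
def dirDeriv {m : ℕ} {M : Type*} [TopologicalSpace M]
    [ChartedSpace (EuclideanSpace ℝ (Fin (2 * m - 1))) M] (Y : M → Mat m) (x : M)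
    (u : TangentSpace (𝓡 (2 * m - 1)) x) : Mat m :=
  mfderiv (𝓡 (2 * m - 1)) 𝓘(ℝ, Mat m) Y x u

/-- `N` is a smooth unit normal vector field of the hypersurface on the open set `U`. -/
structure IsUnitNormal {m : ℕ} {M : Type*} [TopologicalSpace M]
    [ChartedSpace (EuclideanSpace ℝ (Fin (2 * m - 1))) M] (f : M → Mat m) (U : Set M)
    (N : M → Mat m) : Prop where
  isOpen : IsOpen U
  smooth : ContMDiffOn (𝓡 (2 * m - 1)) 𝓘(ℝ, Mat m) ∞ N U
  tangent : ∀ x ∈ U, N x ∈ tangentQ (f x)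
  normal : ∀ x ∈ U, ∀ u : TangentSpace (𝓡 (2 * m - 1)) x, metric (N x) (dirDeriv f x u) = 0
  unit : ∀ x ∈ U, metric (N x) (N x) = 1

/-- `Y` is a smooth vector field on the open subset `U` of `M`, with values written in
`df(TM) ≅ TM`. -/
structure IsTangentField {m : ℕ} {M : Type*} [TopologicalSpace M]
    [ChartedSpace (EuclideanSpace ℝ (Fin (2 * m - 1))) M] (f : M → Mat m) (U : Set M)
    (Y : M → Mat m) : Prop where
  smooth : ContMDiffOn (𝓡 (2 * m - 1)) 𝓘(ℝ, Mat m) ∞ Y U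
  tangent : ∀ x ∈ U, ∃ u : TangentSpace (𝓡 (2 * m - 1)) x, dirDeriv f x u = Y x

/-- The Reeb vector `ξ = -J N` at `x`. -/
def reeb {m : ℕ} {M : Type*} (f N : M → Mat m) (x : M) : Mat m := -cplx (f x) (N x)

/-- The Levi-Civita connection `∇̄_u Y` of `Q^m` for a vector field `Y` along the hypersurface. -/
def nablaBar {m : ℕ} {M : Type*} [TopologicalSpace M]
    [ChartedSpace (EuclideanSpace ℝ (Fin (2 * m - 1))) M] (f Y : M → Mat m) (x : M)
    (u : TangentSpace (𝓡 (2 * m - 1)) x) : Mat m :=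
  projQ (f x) (dirDeriv Y x u)

/-- The shape operator `S u = -∇̄_u N` of the hypersurface (Weingarten formula). -/
def shape {m : ℕ} {M : Type*} [TopologicalSpace M]
    [ChartedSpace (EuclideanSpace ℝ (Fin (2 * m - 1))) M] (f N : M → Mat m) (x : M)
    (u : TangentSpace (𝓡 (2 * m - 1)) x) : Mat m :=
  -nablaBar f N x u

/-- The Levi-Civita connection `∇_u Y` of the induced metric on the hypersurface: the part of
`∇̄_u Y` tangent to the hypersurface. -/
def nabla {m : ℕ} {M : Type*} [TopologicalSpace M]
    [ChartedSpace (EuclideanSpace ℝ (Fin (2 * m - 1))) M] (f N Y : M → Mat m) (x : M)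
    (u : TangentSpace (𝓡 (2 * m - 1)) x) : Mat m :=
  nablaBar f Y x u - metric (nablaBar f Y x u) (N x) • N x

/-- The covariant derivative `(∇_u R̄_N) Y = ∇_u (R̄_N Y) - R̄_N (∇_u Y)` of the normal Jacobi
operator. -/
def nablaNormalJacobi {m : ℕ} {M : Type*} [TopologicalSpace M]
    [ChartedSpace (EuclideanSpace ℝ (Fin (2 * m - 1))) M] (f N Y : M → Mat m) (x : M)
    (u : TangentSpace (𝓡 (2 * m - 1)) x) : Mat m :=
  nabla f N (fun y => jacobi (f y) (N y) (Y y)) x u - jacobi (f x) (N x) (nabla f N Y x u)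

/-- The hypersurface is Hopf: `S ξ = α ξ` for every local unit normal vector field. -/
def IsHopf {m : ℕ} {M : Type*} [TopologicalSpace M]
    [ChartedSpace (EuclideanSpace ℝ (Fin (2 * m - 1))) M] (f : M → Mat m) : Prop :=
  ∀ (U : Set M) (N : M → Mat m), IsUnitNormal f U N →
    ∀ x ∈ U, ∀ u : TangentSpace (𝓡 (2 * m - 1)) x, dirDeriv f x u = reeb f N x →
      ∃ α : ℝ, shape f N x u = α • reeb f N x

/-- The (local) unit normal vector fields of the hypersurface are everywhere `𝔄`-isotropic. -/
def HasIsotropicNormal {m : ℕ} {M : Type*} [TopologicalSpace M]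
    [ChartedSpace (EuclideanSpace ℝ (Fin (2 * m - 1))) M] (f : M → Mat m) : Prop :=
  ∀ (U : Set M) (N : M → Mat m), IsUnitNormal f U N → ∀ x ∈ U, IsIsotropic (f x) (N x)

/-- The normal Jacobi operator is Reeb parallel: `(∇_ξ R̄_N) Y = 0` for all vector fields `Y` tangent
to the hypersurface. -/
def HasReebParallelNormalJacobi {m : ℕ} {M : Type*} [TopologicalSpace M]
    [ChartedSpace (EuclideanSpace ℝ (Fin (2 * m - 1))) M] (f : M → Mat m) : Prop :=
  ∀ (U : Set M) (N Y : M → Mat m), IsUnitNormal f U N → IsTangentField f U Y →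
    ∀ x ∈ U, ∀ u : TangentSpace (𝓡 (2 * m - 1)) x, dirDeriv f x u = reeb f N x →
      nablaNormalJacobi f N Y x u = 0

/-! ### The formulas above in terms of horizontal lifts -/

theorem star_dot_symm {m : ℕ} {z v : Fin (m + 2) → ℂ} (h : star z ⬝ᵥ v = 0) :
    star v ⬝ᵥ z = 0 := by
  rw [Matrix.star_dotProduct, h, star_zero]

theorem OnQuadric.dot {m : ℕ} {z : Fin (m + 2) → ℂ} (h : OnQuadric z) : z ⬝ᵥ z = 0 := by
  simpa [OnQuadric, dotProduct, sq] using h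

theorem OnQuadric.star_dot {m : ℕ} {z : Fin (m + 2) → ℂ} (h : OnQuadric z) :
    star z ⬝ᵥ star z = 0 := by
  rw [Matrix.star_dotProduct_star, h.dot, star_zero]

theorem metric_tangentVec {m : ℕ} {z v w : Fin (m + 2) → ℂ} (hz : IsUnitVec z)
    (hv : star z ⬝ᵥ v = 0) (hw : star z ⬝ᵥ w = 0) :
    metric (tangentVec z v) (tangentVec z w) = (star v ⬝ᵥ w).re := by
  have hz' : star z ⬝ᵥ z = 1 := hz
  have h : v ⬝ᵥ star w = star (star v ⬝ᵥ w) := by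
    rw [dotProduct_comm, Matrix.star_dotProduct]
  simp only [metric, tangentVec, add_mul, mul_add, Matrix.vecMulVec_mul_vecMulVec, hw, hz',
    star_dot_symm hv, Matrix.trace_add, Matrix.trace_vecMulVec, dotProduct_smul,
    zero_smul, one_smul, dotProduct_zero, h, dotProduct_comm z (star z), smul_eq_mul, mul_one]
  simp
  ring

theorem cplx_tangentVec {m : ℕ} {z v : Fin (m + 2) → ℂ} (hz : IsUnitVec z)
    (hv : star z ⬝ᵥ v = 0) :
    cplx (point z) (tangentVec z v) = tangentVec z (Complex.I • v) := by
  have hz' : star z ⬝ᵥ z = 1 := hz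
  simp only [cplx, point, tangentVec, add_mul, mul_add, Matrix.vecMulVec_mul_vecMulVec, hv, hz',
    star_dot_symm hv, zero_smul, one_smul, Matrix.vecMulVec_zero, add_zero, zero_add]
  ext i j
  simp [Matrix.vecMulVec_apply]
  ring

theorem projQ_of_mem {m : ℕ} {P X : Mat m} (hX : X ∈ tangentQ P) : projQ P X = X := by
  obtain ⟨z, v, hz, hq, rfl, hv, hv', rfl⟩ := hX
  have hz' : star z ⬝ᵥ z = 1 := hz
  have hv'' : star v ⬝ᵥ star z = 0 := by rw [Matrix.star_dotProduct_star, hv', star_zero]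
  simp only [projQ, point, tangentVec, Matrix.transpose_vecMulVec, mul_add, sub_mul,
    mul_sub, one_mul, mul_one, Matrix.vecMulVec_mul_vecMulVec, hv, hv', hv'', hz', hq.dot,
    star_dot_symm hv, zero_smul, one_smul, Matrix.vecMulVec_zero, add_zero, zero_add,
    sub_zero, sub_self]

theorem projQ_mem {m : ℕ} {P X : Mat m} (hP : P ∈ quadric m) (hX : X.IsHermitian) :
    projQ P X ∈ tangentQ P := by
  obtain ⟨z, hz, hq, rfl⟩ := hP
  have hz' : star z ⬝ᵥ z = 1 := hz
  have hz'' : z ⬝ᵥ star z = 1 := by rw [dotProduct_comm, hz']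
  set R : Mat m := 1 - point z - (point z)ᵀ with hR
  have hRH : Rᴴ = R := by
    simp [hR, point, Matrix.transpose_vecMulVec, Matrix.conjTranspose_vecMulVec]
  refine ⟨z, R *ᵥ (X *ᵥ z), hz, hq, rfl, ?_, ?_, ?_⟩
  · rw [Matrix.dotProduct_mulVec]
    have : star z ᵥ* R = 0 := by
      simp [hR, point, Matrix.vecMul_sub, Matrix.transpose_vecMulVec, Matrix.vecMul_vecMulVec,
        hz', hq.star_dot]
    rw [this, zero_dotProduct]
  · rw [Matrix.dotProduct_mulVec]
    have : z ᵥ* R = 0 := by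
      simp [hR, point, Matrix.vecMul_sub, Matrix.transpose_vecMulVec, Matrix.vecMul_vecMulVec,
        hz'', hq.dot]
    rw [this, zero_dotProduct]
  · rw [tangentVec, Matrix.star_mulVec, Matrix.star_mulVec, hRH, hX.eq]
    simp only [projQ, ← hR]
    simp only [point, Matrix.mul_vecMulVec, Matrix.vecMulVec_mul, Matrix.mulVec_mulVec]

theorem metric_sub_projQ {m : ℕ} {P X Y : Mat m} (hY : Y ∈ tangentQ P) :
    metric (X - projQ P X) Y = 0 := by
  have h : Matrix.trace (projQ P X * Y) = Matrix.trace (X * projQ P Y) := by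
    set R : Mat m := 1 - P - Pᵀ with hR
    simp only [projQ, ← hR, add_mul, mul_add, Matrix.trace_add]
    rw [Matrix.mul_assoc (R * X), Matrix.mul_assoc R, Matrix.trace_mul_comm R,
      Matrix.mul_assoc (P * X), Matrix.mul_assoc P, Matrix.trace_mul_comm P, add_comm]
    simp only [Matrix.mul_assoc]
  rw [metric, sub_mul, Matrix.trace_sub, h, projQ_of_mem hY, sub_self]
  simp

end ComplexQuadric

end

/-! Write ⟨a,b⟩ for `star a ⬝ᵥ b` and a·b for the bilinear `a ⬝ᵥ b`. Everything is computed on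
horizontal lifts, that is, on vectors of ℂ^{m+2} orthogonal to z and z̄. Let v be the lift of N. Its
phase depends on the phase of z, but whether h = v·v vanishes does not, and N is isotropic exactly
when h = 0 (`isIsotropic_iff`): up to scale, the real and imaginary parts of v are then the required
Z₁ and Z₂.

The Gauss equation for the quadric inside the space of matrices gives the normal Jacobi operator on
lifts (`jacobi_tangentVec`): w ↦ w + (⟨v,w⟩ - 2⟨w,v⟩)v + h w̄ - (v·w)v̄. On a Hopf hypersurface ∇̄_ξ
N = -αξ = αJN, so along ξ the lift v changes, to first order and modulo z and z̄, by the rotation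
iαv. Only ⟨w,v⟩v and h w̄ feel this rotation, each with weight 2, and the first contributes a normal
vector. Hence (∇_ξ R̄_N)Y is the tangential part of 2iαh w̄ (`nablaNormalJacobi_eq`). This vanishes
if h = 0. Conversely, since m ≥ 3 there is w ≠ 0 orthogonal to z, z̄, v and v̄, and testing on it
shows that Reeb parallelism forces αh = 0.

It remains to exclude that h ≠ 0 at some point. On the open set where h ≠ 0 one has α = 0, so Sξ =
0; by symmetry of S the one-form a ↦ ⟨dN(a), JN⟩ vanishes there, and so does its exterior
derivative. In terms of derivatives ξ₁, ξ₂ of the lift of f and v₁, v₂ of the lift of N this reads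
Im⟨v₁,v₂⟩ = Im⟨ξ₁,ξ₂⟩ (`im_star_dot_eq`), which plays the role of the Codazzi equation. Taking one
direction to be the Reeb direction gives |h| = 1 and v = h v̄ (`eq_dot_smul_star`). Differentiating
this relation makes every ⟨v₁,v₂⟩ real, whereas Im⟨w, iw⟩ = |w|² > 0 for a tangent lift w ≠ 0 with
⟨v,w⟩ = 0. This contradiction is `dot_self_eq_zero_of_nablaBar_reeb`. -/

noncomputable section

namespace ComplexQuadric

/-! ### Horizontal lifts -/

/-- `v` is orthogonal to `z` and to `z̄`. -/
structure IsHorizontal {m : ℕ} (z v : Fin (m + 2) → ℂ) : Prop where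
  left : star z ⬝ᵥ v = 0
  right : z ⬝ᵥ v = 0

/-- The orthogonal projection onto the complement of `z` and `z̄`. -/
def hor {m : ℕ} (z a : Fin (m + 2) → ℂ) : Fin (m + 2) → ℂ :=
  a - (star z ⬝ᵥ a) • z - (z ⬝ᵥ a) • star z

theorem dot_star_swap {m : ℕ} (a b : Fin (m + 2) → ℂ) : a ⬝ᵥ star b = star (star a ⬝ᵥ b) := by
  rw [dotProduct_comm, Matrix.star_dotProduct]

theorem star_dot_swap {m : ℕ} (a b : Fin (m + 2) → ℂ) : star (star a ⬝ᵥ b) = star b ⬝ᵥ a := by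
  rw [Matrix.star_dotProduct b a]

theorem IsHorizontal.conj {m : ℕ} {z v : Fin (m + 2) → ℂ} (h : IsHorizontal z v) :
    IsHorizontal z (star v) :=
  ⟨by rw [Matrix.star_dotProduct_star, dotProduct_comm, h.right, star_zero], by
    rw [dot_star_swap, h.left, star_zero]⟩

theorem IsHorizontal.add {m : ℕ} {z v w : Fin (m + 2) → ℂ} (hv : IsHorizontal z v)
    (hw : IsHorizontal z w) : IsHorizontal z (v + w) :=
  ⟨by rw [dotProduct_add, hv.left, hw.left, add_zero],
    by rw [dotProduct_add, hv.right, hw.right, add_zero]⟩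

theorem IsHorizontal.smul {m : ℕ} {z v : Fin (m + 2) → ℂ} (hv : IsHorizontal z v) (c : ℂ) :
    IsHorizontal z (c • v) :=
  ⟨by rw [dotProduct_smul, hv.left, smul_zero], by rw [dotProduct_smul, hv.right, smul_zero]⟩

theorem IsHorizontal.sub {m : ℕ} {z v w : Fin (m + 2) → ℂ} (hv : IsHorizontal z v)
    (hw : IsHorizontal z w) : IsHorizontal z (v - w) :=
  ⟨by rw [dotProduct_sub, hv.left, hw.left, sub_zero],
    by rw [dotProduct_sub, hv.right, hw.right, sub_zero]⟩

theorem hor_isHorizontal {m : ℕ} {z : Fin (m + 2) → ℂ} (hz : IsUnitVec z) (hq : OnQuadric z)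
    (a : Fin (m + 2) → ℂ) : IsHorizontal z (hor z a) := by
  have hz' : star z ⬝ᵥ z = 1 := hz
  have hz'' : z ⬝ᵥ star z = 1 := by rw [dotProduct_comm, hz']
  constructor <;> simp [hor, dotProduct_sub, hz', hz'', hq.dot, hq.star_dot]

theorem IsHorizontal.hor_eq {m : ℕ} {z v : Fin (m + 2) → ℂ} (h : IsHorizontal z v) :
    hor z v = v := by
  simp [hor, h.left, h.right]

theorem hor_add {m : ℕ} (z a b : Fin (m + 2) → ℂ) : hor z (a + b) = hor z a + hor z b := by
  simp only [hor, dotProduct_add, add_smul]; abel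

theorem hor_sub {m : ℕ} (z a b : Fin (m + 2) → ℂ) : hor z (a - b) = hor z a - hor z b := by
  simp only [hor, dotProduct_sub, sub_smul]; abel

theorem hor_smul {m : ℕ} (z : Fin (m + 2) → ℂ) (c : ℂ) (a : Fin (m + 2) → ℂ) :
    hor z (c • a) = c • hor z a := by
  simp only [hor, dotProduct_smul, smul_sub, smul_smul, smul_eq_mul]

theorem hor_neg {m : ℕ} (z a : Fin (m + 2) → ℂ) : hor z (-a) = -hor z a := by
  simpa using hor_smul z (-1) a

theorem hor_self {m : ℕ} {z : Fin (m + 2) → ℂ} (hz : IsUnitVec z) (hq : OnQuadric z) :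
    hor z z = 0 := by
  have hz' : star z ⬝ᵥ z = 1 := hz
  simp [hor, hz', hq.dot]

theorem hor_star_self {m : ℕ} {z : Fin (m + 2) → ℂ} (hz : IsUnitVec z) (hq : OnQuadric z) :
    hor z (star z) = 0 := by
  have hz' : z ⬝ᵥ star z = 1 := by rw [dotProduct_comm]; exact hz
  simp [hor, hz', hq.star_dot]

theorem hor_star {m : ℕ} (z a : Fin (m + 2) → ℂ) : hor z (star a) = star (hor z a) := by
  simp only [hor, star_sub, star_smul, star_star]
  rw [Matrix.star_dotProduct_star, dot_star_swap, dotProduct_comm a z]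
  abel

/-- Pairings with horizontal vectors do not see the components along z and z̄. This lets derivatives
of lifts, which need not be horizontal, be replaced by their horizontal parts. -/
theorem IsHorizontal.dot_hor {m : ℕ} {z v : Fin (m + 2) → ℂ} (h : IsHorizontal z v)
    (a : Fin (m + 2) → ℂ) : v ⬝ᵥ a = v ⬝ᵥ hor z a := by
  simp [hor, dotProduct_comm v, h.left, h.right]

theorem IsHorizontal.star_dot_hor {m : ℕ} {z v : Fin (m + 2) → ℂ} (h : IsHorizontal z v)
    (a : Fin (m + 2) → ℂ) : star v ⬝ᵥ a = star v ⬝ᵥ hor z a :=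
  h.conj.dot_hor a

theorem eq_zero_of_star_dot {m : ℕ} {a : Fin (m + 2) → ℂ} (h : star a ⬝ᵥ a = 0) : a = 0 := by
  have h' : WithLp.toLp 2 a = 0 := by
    rw [← inner_self_eq_zero (𝕜 := ℂ), EuclideanSpace.inner_eq_star_dotProduct, dotProduct_comm]
    exact h
  simpa using h'

theorem star_dot_self_im {m : ℕ} (a : Fin (m + 2) → ℂ) : (star a ⬝ᵥ a).im = 0 := by
  have h := congrArg Complex.im (star_dot_swap a a)
  simp only [Complex.star_def, Complex.conj_im] at h
  linarith

/-! ### Tangent matrices versus lifts, and independence of the phase of z. -/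

theorem tangentVec_mulVec {m : ℕ} {z v : Fin (m + 2) → ℂ} (hz : IsUnitVec z)
    (hv : star z ⬝ᵥ v = 0) : tangentVec z v *ᵥ z = v := by
  have hz' : star z ⬝ᵥ z = 1 := hz
  simp [tangentVec, Matrix.add_mulVec, Matrix.vecMulVec_mulVec, hz', star_dot_symm hv]

theorem point_mulVec {m : ℕ} {z : Fin (m + 2) → ℂ} (hz : IsUnitVec z) :
    point z *ᵥ z = z := by
  have hz' : star z ⬝ᵥ z = 1 := hz
  simp [point, Matrix.vecMulVec_mulVec, hz']

theorem tangentVec_isHermitian {m : ℕ} (z v : Fin (m + 2) → ℂ) :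
    (tangentVec z v).IsHermitian := by
  simp [Matrix.IsHermitian, tangentVec, Matrix.conjTranspose_vecMulVec, add_comm]

theorem point_isHermitian {m : ℕ} (z : Fin (m + 2) → ℂ) : (point z).IsHermitian := by
  simp [Matrix.IsHermitian, point, Matrix.conjTranspose_vecMulVec]

theorem isHermitian_of_mem_tangentQ {m : ℕ} {P X : Mat m} (h : X ∈ tangentQ P) :
    X.IsHermitian := by
  obtain ⟨z, v, -, -, -, -, -, rfl⟩ := h
  exact tangentVec_isHermitian z v

theorem tangentVec_add {m : ℕ} (z v w : Fin (m + 2) → ℂ) :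
    tangentVec z (v + w) = tangentVec z v + tangentVec z w := by
  simp only [tangentVec, Matrix.add_vecMulVec, star_add, Matrix.vecMulVec_add]
  abel

theorem tangentVec_smul {m : ℕ} (z v : Fin (m + 2) → ℂ) (r : ℝ) :
    tangentVec z ((r : ℂ) • v) = r • tangentVec z v := by
  ext i j
  simp [tangentVec, Matrix.vecMulVec_apply]


theorem tangentVec_sub {m : ℕ} (z v w : Fin (m + 2) → ℂ) :
    tangentVec z (v - w) = tangentVec z v - tangentVec z w := by
  simp only [tangentVec, Matrix.sub_vecMulVec, star_sub, Matrix.vecMulVec_sub]; abel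

theorem tangentVec_neg {m : ℕ} (z v : Fin (m + 2) → ℂ) :
    tangentVec z (-v) = -tangentVec z v := by
  simp only [tangentVec, Matrix.neg_vecMulVec, star_neg, Matrix.vecMulVec_neg]; abel

theorem tangentVec_zero {m : ℕ} (z : Fin (m + 2) → ℂ) : tangentVec z 0 = 0 := by
  simp [tangentVec]

theorem tangentVec_mem {m : ℕ} {z v : Fin (m + 2) → ℂ} (hz : IsUnitVec z) (hq : OnQuadric z)
    (hv : IsHorizontal z v) : tangentVec z v ∈ tangentQ (point z) :=
  ⟨z, v, hz, hq, rfl, hv.left, hv.right, rfl⟩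

/-- Unit vectors spanning the same complex line differ by a phase. -/
theorem exists_phase {m : ℕ} {z z' : Fin (m + 2) → ℂ} (hz : IsUnitVec z) (hz' : IsUnitVec z')
    (h : point z = point z') : ∃ c : ℂ, c * star c = 1 ∧ z' = c • z := by
  have h1 : z' = (star z ⬝ᵥ z') • z := by
    conv_lhs => rw [← point_mulVec hz', ← h]
    simp [point, Matrix.vecMulVec_mulVec]
  refine ⟨_, ?_, h1⟩
  have h2 : star z' ⬝ᵥ z' = 1 := hz'
  have h3 : star z ⬝ᵥ z = 1 := hz
  generalize star z ⬝ᵥ z' = c at h1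
  subst h1
  simpa [h3, mul_comm] using h2

theorem point_smul {m : ℕ} {c : ℂ} (hc : c * star c = 1) (z : Fin (m + 2) → ℂ) :
    point (c • z) = point z := by
  simp only [point, star_smul, Matrix.smul_vecMulVec, Matrix.vecMulVec_smul, smul_smul,
    mul_comm (star c), hc, one_smul]

theorem tangentVec_smul_left {m : ℕ} (c : ℂ) (z v : Fin (m + 2) → ℂ) :
    tangentVec (c • z) v = tangentVec z (star c • v) := by
  simp only [tangentVec, star_smul, star_star, Matrix.smul_vecMulVec, Matrix.vecMulVec_smul]

theorem onQuadric_smul {m : ℕ} {z : Fin (m + 2) → ℂ} (h : OnQuadric z) (c : ℂ) :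
    OnQuadric (c • z) := by
  simp only [OnQuadric, Pi.smul_apply, smul_eq_mul, mul_pow, ← Finset.mul_sum]
  rw [show ∑ i, z i ^ 2 = 0 from h, mul_zero]

theorem onQuadric_of_point_mem {m : ℕ} {z : Fin (m + 2) → ℂ} (hz : IsUnitVec z)
    (h : point z ∈ quadric m) : OnQuadric z := by
  obtain ⟨z', hz', hq, h'⟩ := h
  obtain ⟨c, -, rfl⟩ := exists_phase hz' hz h'.symm
  exact onQuadric_smul hq c

theorem exists_horizontal {m : ℕ} {z : Fin (m + 2) → ℂ} {X : Mat m} (hz : IsUnitVec z)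
    (hX : X ∈ tangentQ (point z)) : ∃ v, IsHorizontal z v ∧ X = tangentVec z v := by
  obtain ⟨z', v, hz', -, h, hv, hv', rfl⟩ := hX
  obtain ⟨c, hc, rfl⟩ := exists_phase hz hz' h
  have hc0 : c ≠ 0 := fun h0 => by simp [h0] at hc
  refine ⟨star c • v, IsHorizontal.smul ⟨?_, ?_⟩ _, tangentVec_smul_left c z v⟩
  · simpa [hc0] using hv
  · simpa [hc0] using hv'

theorem exists_horizontal_tangentCP {m : ℕ} {z : Fin (m + 2) → ℂ} {X : Mat m} (hz : IsUnitVec z)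
    (hX : X ∈ tangentCP (point z)) : ∃ v, star z ⬝ᵥ v = 0 ∧ X = tangentVec z v := by
  obtain ⟨z', v, hz', h, hv, rfl⟩ := hX
  obtain ⟨c, hc, rfl⟩ := exists_phase hz hz' h
  have hc0 : c ≠ 0 := fun h0 => by simp [h0] at hc
  refine ⟨star c • v, ?_, tangentVec_smul_left c z v⟩
  rw [dotProduct_smul]
  simpa [hc0] using hv

theorem projQ_point {m : ℕ} {z : Fin (m + 2) → ℂ} {X : Mat m} (hX : X.IsHermitian) :
    projQ (point z) X = tangentVec z (hor z (X *ᵥ z)) := by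
  set R : Mat m := 1 - point z - (point z)ᵀ with hR
  have hRH : Rᴴ = R := by
    simp [hR, point, Matrix.transpose_vecMulVec, Matrix.conjTranspose_vecMulVec]
  have hh : hor z (X *ᵥ z) = R *ᵥ (X *ᵥ z) := by
    simp only [hor, hR, point, Matrix.sub_mulVec, Matrix.transpose_vecMulVec,
      Matrix.vecMulVec_mulVec, Matrix.one_mulVec, op_smul_eq_smul]
  rw [hh, tangentVec, Matrix.star_mulVec, Matrix.star_mulVec, hRH, hX.eq]
  simp only [projQ, ← hR]
  simp only [point, Matrix.mul_vecMulVec, Matrix.vecMulVec_mul, Matrix.mulVec_mulVec]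

/-! ### The curvature tensor -/

/-- The derivative of `P ↦ projQ P W` in the direction `X`. -/
def dprojQ {m : ℕ} (P X W : Mat m) : Mat m :=
  -(X + Xᵀ) * W * P + (1 - P - Pᵀ) * W * X + X * W * (1 - P - Pᵀ) - P * W * (X + Xᵀ)

/-- The second fundamental form of the quadric in the space of matrices. -/
def sndForm {m : ℕ} (z x w : Fin (m + 2) → ℂ) : Mat m :=
  Matrix.vecMulVec x (star w) + Matrix.vecMulVec w (star x)
    - (star x ⬝ᵥ w + star w ⬝ᵥ x) • Matrix.vecMulVec z (star z)
    - (x ⬝ᵥ w) • Matrix.vecMulVec (star z) (star z)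
    - star (x ⬝ᵥ w) • Matrix.vecMulVec z z

theorem sndForm_isHermitian {m : ℕ} (z x w : Fin (m + 2) → ℂ) : (sndForm z x w).IsHermitian := by
  have h1 : star (star x ⬝ᵥ w) = star w ⬝ᵥ x := star_dot_swap x w
  have h2 : star (star w ⬝ᵥ x) = star x ⬝ᵥ w := star_dot_swap w x
  simp only [Matrix.IsHermitian, sndForm, Matrix.conjTranspose_sub, Matrix.conjTranspose_add,
    Matrix.conjTranspose_smul, Matrix.conjTranspose_vecMulVec, star_star, star_add, h1, h2]
  rw [add_comm (Matrix.vecMulVec w _), add_comm (star w ⬝ᵥ x)]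
  abel

/-- The derivative of the tangential projector, applied to a tangent vector, is the second
fundamental form; this is its value on lifts. -/
theorem dprojQ_tangentVec {m : ℕ} {z x w : Fin (m + 2) → ℂ} (hz : IsUnitVec z)
    (hq : OnQuadric z) (hx : IsHorizontal z x) (hw : IsHorizontal z w) :
    dprojQ (point z) (tangentVec z x) (tangentVec z w) = sndForm z x w := by
  have e1 : star z ⬝ᵥ z = 1 := hz
  have e3 := hx.left
  have e5 := hw.left
  have e6 := hw.right
  have f4 : x ⬝ᵥ z = 0 := by rw [dotProduct_comm]; exact hx.right
  have f8 : star x ⬝ᵥ z = 0 := by rw [dotProduct_comm]; exact hx.conj.right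
  have f9 : star w ⬝ᵥ star z = 0 := by rw [dotProduct_comm]; exact hw.conj.left
  have f10 : star w ⬝ᵥ z = 0 := by rw [dotProduct_comm]; exact hw.conj.right
  have g : star w ⬝ᵥ star x = star (x ⬝ᵥ w) := by
    rw [Matrix.star_dotProduct_star, dotProduct_comm]
  simp only [dprojQ, point, tangentVec, sndForm, Matrix.transpose_add, Matrix.transpose_vecMulVec,
    add_mul, mul_add, sub_mul, mul_sub, neg_mul, one_mul, mul_one,
    Matrix.vecMulVec_mul_vecMulVec, Matrix.vecMulVec_smul, smul_mul_assoc, e1, e3, e5, e6, f4, f8,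
    f9, f10, hq.dot, hq.star_dot, zero_smul, one_smul, Matrix.vecMulVec_zero, add_zero, zero_add,
    smul_zero, sub_zero, add_smul, g]
  abel

/-- This is one of the two terms of the Gauss equation; antisymmetrizing it in x and v gives the
curvature tensor. -/
theorem projQ_dprojQ_sndForm {m : ℕ} {z x v w : Fin (m + 2) → ℂ} (hz : IsUnitVec z)
    (hq : OnQuadric z) (hx : IsHorizontal z x) (hv : IsHorizontal z v) (hw : IsHorizontal z w) :
    projQ (point z) (dprojQ (point z) (tangentVec z x) (sndForm z v w)) =
      tangentVec z ((star v ⬝ᵥ w + star w ⬝ᵥ v) • x + (v ⬝ᵥ w) • star x +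
        (star w ⬝ᵥ x) • v + (star v ⬝ᵥ x) • w) := by
  have e1 : star z ⬝ᵥ z = 1 := hz
  have e2 : z ⬝ᵥ star z = 1 := by rw [dotProduct_comm, e1]
  have e3 := hx.left
  have e4 := hx.right
  have f3 : x ⬝ᵥ star z = 0 := by rw [dotProduct_comm]; exact e3
  have f4 : x ⬝ᵥ z = 0 := by rw [dotProduct_comm]; exact e4
  have f7 : star x ⬝ᵥ star z = 0 := by rw [dotProduct_comm]; exact hx.conj.left
  have f10 : star w ⬝ᵥ z = 0 := by rw [dotProduct_comm]; exact hw.conj.right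
  have f12 : star v ⬝ᵥ z = 0 := by rw [dotProduct_comm]; exact hv.conj.right
  have herm : (dprojQ (point z) (tangentVec z x) (sndForm z v w)).IsHermitian := by
    have hP := (point_isHermitian z).eq
    have hX := (tangentVec_isHermitian z x).eq
    have hB := (sndForm_isHermitian z v w).eq
    have hPt : (point z)ᵀᴴ = (point z)ᵀ := by
      rw [Matrix.conjTranspose_transpose_eq_transpose_conjTranspose, hP]
    have hXt : (tangentVec z x)ᵀᴴ = (tangentVec z x)ᵀ := by
      rw [Matrix.conjTranspose_transpose_eq_transpose_conjTranspose, hX]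
    simp only [Matrix.IsHermitian, dprojQ, Matrix.conjTranspose_sub, Matrix.conjTranspose_add,
      Matrix.conjTranspose_mul, Matrix.conjTranspose_neg, Matrix.conjTranspose_one, hP, hX, hB,
      hPt, hXt]
    noncomm_ring
  rw [projQ_point herm]
  congr 1
  -- The lift is read off by applying the matrix to z and projecting, so only the values of each
  -- factor on z, z̄ and x are needed.
  have hBz : sndForm z v w *ᵥ z =
      -(star v ⬝ᵥ w + star w ⬝ᵥ v) • z - (v ⬝ᵥ w) • star z := by
    simp only [sndForm, Matrix.sub_mulVec, Matrix.add_mulVec, Matrix.smul_mulVec, neg_smul,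
      Matrix.vecMulVec_mulVec, f10, f12, e1, hq.dot, op_smul_eq_smul, zero_smul, smul_zero,
      add_zero, zero_sub, sub_zero, one_smul]
  have hR : (1 - point z - (point z)ᵀ) *ᵥ z = 0 := by
    simp [point, Matrix.sub_mulVec, Matrix.transpose_vecMulVec, Matrix.vecMulVec_mulVec, e1, hq.dot]
  have hRz : ∀ C : Mat m, (C * (1 - point z - (point z)ᵀ)) *ᵥ z = 0 := by
    intro C
    rw [← Matrix.mulVec_mulVec, hR, Matrix.mulVec_zero]
  have hRh : ∀ a, (1 - point z - (point z)ᵀ) *ᵥ a = hor z a := by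
    intro a
    simp [hor, point, Matrix.sub_mulVec, Matrix.transpose_vecMulVec, Matrix.vecMulVec_mulVec]
  have hPh : ∀ a, hor z (point z *ᵥ a) = 0 := by
    intro a
    simp [point, Matrix.vecMulVec_mulVec, hor_smul, hor_self hz hq]
  have hXz : tangentVec z x *ᵥ z = x := tangentVec_mulVec hz e3
  have hXzs : tangentVec z x *ᵥ star z = 0 := by
    simp [tangentVec, Matrix.add_mulVec, Matrix.vecMulVec_mulVec, hq.star_dot, f7]
  have hXtz : (tangentVec z x)ᵀ *ᵥ z = 0 := by
    simp [tangentVec, Matrix.add_mulVec, Matrix.transpose_vecMulVec, Matrix.vecMulVec_mulVec,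
      hq.dot, f4]
  have hXtzs : (tangentVec z x)ᵀ *ᵥ star z = star x := by
    simp [tangentVec, Matrix.add_mulVec, Matrix.transpose_vecMulVec, Matrix.vecMulVec_mulVec,
      e2, f3]
  have hBx : hor z (sndForm z v w *ᵥ x) = (star w ⬝ᵥ x) • v + (star v ⬝ᵥ x) • w := by
    simp [sndForm, Matrix.sub_mulVec, Matrix.add_mulVec, Matrix.smul_mulVec,
      Matrix.vecMulVec_mulVec, e3, e4, hor_add, hor_smul, hv.hor_eq, hw.hor_eq]
  rw [dprojQ, Matrix.sub_mulVec, Matrix.add_mulVec, Matrix.add_mulVec, hRz, mul_assoc (point z),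
    mul_assoc (-_), mul_assoc (_ - _)]
  simp only [← Matrix.mulVec_mulVec, point_mulVec hz, hXz, hBz, hPh, hRh, hor_sub, hor_add,
    Matrix.neg_mulVec, Matrix.add_mulVec, Matrix.mulVec_sub, Matrix.mulVec_smul, hXzs, hXtz, hXtzs]
  rw [(hor_isHorizontal hz hq _).hor_eq, hBx]
  have h0 : hor z (0 : Fin (m + 2) → ℂ) = 0 := by simp [hor]
  simp only [sub_zero, add_zero, zero_add, hor_smul, h0,
    hx.hor_eq, hx.conj.hor_eq, hor_neg]
  module

/-! ### Derivatives of matrix-valued curves -/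

theorem hasDerivAt_transpose {m : ℕ} {A : ℝ → Mat m} {A' : Mat m} {t : ℝ}
    (h : HasDerivAt A A' t) : HasDerivAt (fun s => (A s)ᵀ) A'ᵀ t :=
  (LinearMap.toContinuousLinearMap
    (Matrix.transposeLinearEquiv (Fin (m + 2)) (Fin (m + 2)) ℝ ℂ).toLinearMap).hasFDerivAt
      |>.comp_hasDerivAt t h

theorem contDiff_transpose {m : ℕ} {n : ℕ∞ω} : ContDiff ℝ n (fun A : Mat m => Aᵀ) :=
  (LinearMap.toContinuousLinearMap
    (Matrix.transposeLinearEquiv (Fin (m + 2)) (Fin (m + 2)) ℝ ℂ).toLinearMap).contDiff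

theorem hasDerivAt_mat_add {m : ℕ} {A B : ℝ → Mat m} {A' B' : Mat m} {t : ℝ}
    (hA : HasDerivAt A A' t) (hB : HasDerivAt B B' t) :
    HasDerivAt (fun s => A s + B s) (A' + B') t := hA.add hB

theorem hasDerivAt_mat_sub {m : ℕ} {A B : ℝ → Mat m} {A' B' : Mat m} {t : ℝ}
    (hA : HasDerivAt A A' t) (hB : HasDerivAt B B' t) :
    HasDerivAt (fun s => A s - B s) (A' - B') t := hA.sub hB

theorem hasDerivAt_mat_neg {m : ℕ} {A : ℝ → Mat m} {A' : Mat m} {t : ℝ}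
    (hA : HasDerivAt A A' t) : HasDerivAt (fun s => -A s) (-A') t := hA.neg

theorem hasDerivAt_mat_mul {m : ℕ} {A B : ℝ → Mat m} {A' B' : Mat m} {t : ℝ}
    (hA : HasDerivAt A A' t) (hB : HasDerivAt B B' t) :
    HasDerivAt (fun s => A s * B s) (A' * B t + A t * B') t := hA.mul hB

theorem hasDerivAt_one_sub_sub {m : ℕ} {A : ℝ → Mat m} {A' : Mat m} {t : ℝ}
    (hA : HasDerivAt A A' t) : HasDerivAt (fun s => 1 - A s - (A s)ᵀ) (0 - A' - A'ᵀ) t :=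
  hasDerivAt_mat_sub (hasDerivAt_mat_sub (hasDerivAt_const t (1 : Mat m)) hA)
    (hasDerivAt_transpose hA)

theorem hasDerivAt_projQ {m : ℕ} {A W : ℝ → Mat m} {A' W' : Mat m} {t : ℝ}
    (hA : HasDerivAt A A' t) (hW : HasDerivAt W W' t) :
    HasDerivAt (fun s => projQ (A s) (W s)) (dprojQ (A t) A' (W t) + projQ (A t) W') t := by
  have hR := hasDerivAt_one_sub_sub hA
  have h := hasDerivAt_mat_add (hasDerivAt_mat_mul (hasDerivAt_mat_mul hR hW) hA)
    (hasDerivAt_mat_mul (hasDerivAt_mat_mul hA hW) hR)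
  refine HasDerivAt.congr_deriv (f := fun s => projQ (A s) (W s)) h ?_
  simp only [dprojQ, projQ]
  noncomm_ring

/-- The second derivative of `P ↦ projQ P W`. -/
def ddprojQ {m : ℕ} (U X W : Mat m) : Mat m :=
  -(X + Xᵀ) * W * U - (U + Uᵀ) * W * X - X * W * (U + Uᵀ) - U * W * (X + Xᵀ)

theorem ddprojQ_comm {m : ℕ} (U X W : Mat m) : ddprojQ U X W = ddprojQ X U W := by
  simp only [ddprojQ]
  noncomm_ring

theorem hasDerivAt_dprojQ {m : ℕ} {A X : ℝ → Mat m} {A' X' : Mat m} {t : ℝ}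
    (hA : HasDerivAt A A' t) (hX : HasDerivAt X X' t) (W : Mat m) :
    HasDerivAt (fun s => dprojQ (A s) (X s) W)
      (ddprojQ A' (X t) W + dprojQ (A t) X' W) t := by
  have hR := hasDerivAt_one_sub_sub hA
  have hS : HasDerivAt (fun s => X s + (X s)ᵀ) (X' + X'ᵀ) t :=
    hasDerivAt_mat_add hX (hasDerivAt_transpose hX)
  have hW := hasDerivAt_const t W
  have h := hasDerivAt_mat_sub (hasDerivAt_mat_add (hasDerivAt_mat_add
    (hasDerivAt_mat_mul (hasDerivAt_mat_mul (hasDerivAt_mat_neg hS) hW) hA)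
    (hasDerivAt_mat_mul (hasDerivAt_mat_mul hR hW) hX))
    (hasDerivAt_mat_mul (hasDerivAt_mat_mul hX hW) hR))
    (hasDerivAt_mat_mul (hasDerivAt_mat_mul hA hW) hS)
  refine HasDerivAt.congr_deriv (f := fun s => dprojQ (A s) (X s) W) h ?_
  simp only [dprojQ, ddprojQ]
  noncomm_ring

theorem contDiff_mat_mul {m : ℕ} {n : ℕ∞ω} {E : Type*} [NormedAddCommGroup E] [NormedSpace ℝ E]
    {f g : E → Mat m} (hf : ContDiff ℝ n f) (hg : ContDiff ℝ n g) :
    ContDiff ℝ n (fun p => f p * g p) := hf.mul hg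

theorem contDiff_one_sub_sub {m : ℕ} {n : ℕ∞ω} {E : Type*} [NormedAddCommGroup E]
    [NormedSpace ℝ E] {f : E → Mat m} (hf : ContDiff ℝ n f) :
    ContDiff ℝ n (fun p => 1 - f p - (f p)ᵀ) :=
  (contDiff_const.sub hf).sub (contDiff_transpose.comp hf)

theorem contDiff_projQ {m : ℕ} {n : ℕ∞ω} {E : Type*} [NormedAddCommGroup E] [NormedSpace ℝ E]
    {f g : E → Mat m} (hf : ContDiff ℝ n f) (hg : ContDiff ℝ n g) :
    ContDiff ℝ n (fun p => projQ (f p) (g p)) := by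
  have hR := contDiff_one_sub_sub hf
  exact ContDiff.add (contDiff_mat_mul (contDiff_mat_mul hR hg) hf)
    (contDiff_mat_mul (contDiff_mat_mul hf hg) hR)

theorem contDiff_dprojQ {m : ℕ} {n : ℕ∞ω} {E : Type*} [NormedAddCommGroup E] [NormedSpace ℝ E]
    {f g h : E → Mat m} (hf : ContDiff ℝ n f) (hg : ContDiff ℝ n g) (hh : ContDiff ℝ n h) :
    ContDiff ℝ n (fun p => dprojQ (f p) (g p) (h p)) := by
  have hR := contDiff_one_sub_sub hf
  have hS : ContDiff ℝ n (fun p => g p + (g p)ᵀ) := hg.add (contDiff_transpose.comp hg)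
  have hS' : ContDiff ℝ n (fun p => -(g p + (g p)ᵀ)) := hS.neg
  exact ContDiff.sub (ContDiff.add (ContDiff.add
    (contDiff_mat_mul (contDiff_mat_mul hS' hh) hf) (contDiff_mat_mul (contDiff_mat_mul hR hh) hg))
    (contDiff_mat_mul (contDiff_mat_mul hg hh) hR)) (contDiff_mat_mul (contDiff_mat_mul hf hh) hS)

theorem hasDerivAt_line {m : ℕ} (P u : Mat m) :
    HasDerivAt (fun t : ℝ => P + t • u) u 0 := by
  simpa using ((hasDerivAt_id (0 : ℝ)).smul_const u).const_add P

theorem fderiv_eq_of_line {m : ℕ} {g : Mat m → Mat m} {P u g' : Mat m}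
    (hg : DifferentiableAt ℝ g P) (h : HasDerivAt (fun t : ℝ => g (P + t • u)) g' 0) :
    fderiv ℝ g P u = g' := by
  rw [← hg.lineDeriv_eq_fderiv]
  exact HasLineDerivAt.lineDeriv h

theorem projQ_zero {m : ℕ} (P : Mat m) : projQ P 0 = 0 := by simp [projQ]

theorem fderiv_projQ {m : ℕ} (W P u : Mat m) :
    fderiv ℝ (fun P' => projQ P' W) P u = dprojQ P u W := by
  have h1 : DifferentiableAt ℝ (fun P' : Mat m => projQ P' W) P :=
    (contDiff_projQ (n := 1) contDiff_id contDiff_const).differentiable one_ne_zero P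
  have h2 : HasDerivAt (fun t : ℝ => projQ (P + t • u) W) (dprojQ P u W) 0 := by
    have h := hasDerivAt_projQ (hasDerivAt_line P u) (hasDerivAt_const 0 W)
    simpa [projQ_zero] using h
  exact fderiv_eq_of_line h1 h2

theorem projQ_add {m : ℕ} (P X Y : Mat m) : projQ P (X + Y) = projQ P X + projQ P Y := by
  simp only [projQ]; noncomm_ring

theorem projQ_sub {m : ℕ} (P X Y : Mat m) : projQ P (X - Y) = projQ P X - projQ P Y := by
  simp only [projQ]; noncomm_ring

theorem dprojQ_sub {m : ℕ} (P X Y W : Mat m) :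
    dprojQ P (X - Y) W = dprojQ P X W - dprojQ P Y W := by
  simp only [dprojQ, Matrix.transpose_sub]; noncomm_ring

theorem projQ_projQ {m : ℕ} {z : Fin (m + 2) → ℂ} (hz : IsUnitVec z) (hq : OnQuadric z)
    (X : Mat m) : projQ (point z) (projQ (point z) X) = projQ (point z) X := by
  have hz' : star z ⬝ᵥ z = 1 := hz
  have hz'' : z ⬝ᵥ star z = 1 := by rw [dotProduct_comm, hz']
  set P := point z with hP
  set R := 1 - P - Pᵀ with hR
  have h1 : P * P = P := by
    simp [hP, point, Matrix.vecMulVec_mul_vecMulVec, hz']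
  have h2 : P * Pᵀ = 0 := by
    simp [hP, point, Matrix.transpose_vecMulVec, Matrix.vecMulVec_mul_vecMulVec, hq.star_dot]
  have h3 : Pᵀ * P = 0 := by
    simp [hP, point, Matrix.transpose_vecMulVec, Matrix.vecMulVec_mul_vecMulVec, hq.dot]
  have h4 : Pᵀ * Pᵀ = Pᵀ := by
    simp [hP, point, Matrix.transpose_vecMulVec, Matrix.vecMulVec_mul_vecMulVec, hz'']
  have h5 : R * P = 0 := by simp [hR, sub_mul, h1, h3]
  have h6 : P * R = 0 := by simp [hR, mul_sub, h1, h2]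
  have h7 : R * R = R := by
    conv_lhs => rw [hR]
    simp only [sub_mul, mul_sub, one_mul, mul_one, h1, h2, h3, h4, hR]
    abel
  simp only [projQ, ← hR]
  have e : R * (R * X * P + P * X * R) * P + P * (R * X * P + P * X * R) * R
      = (R * R) * X * (P * P) + (R * P) * X * R * P + (P * R) * X * P * R
        + (P * P) * X * (R * R) := by noncomm_ring
  rw [e, h1, h5, h6, h7]
  simp

/-- This is the Gauss equation. The extensions P' ↦ `projQ P' u` are polynomial on the whole matrix
space, so all derivatives are explicit. -/
theorem curvature_eq {m : ℕ} {z : Fin (m + 2) → ℂ} (hz : IsUnitVec z) (hq : OnQuadric z)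
    {u v : Mat m} (hu : u ∈ tangentQ (point z)) (hv : v ∈ tangentQ (point z)) (w : Mat m) :
    curvature (point z) u v w =
      projQ (point z) (dprojQ (point z) u (dprojQ (point z) v w)
        - dprojQ (point z) v (dprojQ (point z) u w)) := by
  have key : ∀ a b P : Mat m,
      fderiv ℝ (nablaQ (fun P' => projQ P' b) (fun P' => projQ P' w)) P a =
        dprojQ P a (dprojQ P (projQ P b) w) +
          projQ P (ddprojQ a (projQ P b) w + dprojQ P (dprojQ P a b) w) := by
    intro a b P
    have hn : nablaQ (fun P' => projQ P' b) (fun P' => projQ P' w) =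
        fun P' => projQ P' (dprojQ P' (projQ P' b) w) := by
      funext P'
      rw [nablaQ, fderiv_projQ]
    rw [hn]
    have h1 : DifferentiableAt ℝ (fun P' : Mat m => projQ P' (dprojQ P' (projQ P' b) w)) P :=
      (contDiff_projQ (n := 1) contDiff_id (contDiff_dprojQ contDiff_id
        (contDiff_projQ contDiff_id contDiff_const) contDiff_const)).differentiable one_ne_zero P
    have h2 : HasDerivAt (fun t : ℝ => projQ (P + t • a)
        (dprojQ (P + t • a) (projQ (P + t • a) b) w)) (dprojQ P a (dprojQ P (projQ P b) w) +
          projQ P (ddprojQ a (projQ P b) w + dprojQ P (dprojQ P a b) w)) 0 := by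
      have hl := hasDerivAt_line P a
      have h := hasDerivAt_projQ hl (hasDerivAt_dprojQ hl
        (hasDerivAt_projQ hl (hasDerivAt_const 0 b)) w)
      simpa [projQ_zero] using h
    exact fderiv_eq_of_line h1 h2
  have hu' := projQ_of_mem hu
  have hv' := projQ_of_mem hv
  simp only [curvature, curvatureField]
  have hb : VectorField.lieBracket ℝ (fun P' => projQ P' u) (fun P' => projQ P' v) (point z) =
      dprojQ (point z) u v - dprojQ (point z) v u := by
    rw [VectorField.lieBracket_eq]
    simp only [fderiv_projQ, hu', hv']
  have e1 : nablaQ (fun P' => projQ P' u) (nablaQ (fun P' => projQ P' v) fun P' => projQ P' w)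
      (point z) = projQ (point z) (fderiv ℝ
        (nablaQ (fun P' => projQ P' v) (fun P' => projQ P' w)) (point z) u) := by
    rw [nablaQ, hu']
  have e2 : nablaQ (fun P' => projQ P' v) (nablaQ (fun P' => projQ P' u) fun P' => projQ P' w)
      (point z) = projQ (point z) (fderiv ℝ
        (nablaQ (fun P' => projQ P' u) (fun P' => projQ P' w)) (point z) v) := by
    rw [nablaQ, hv']
  have e3 : nablaQ (VectorField.lieBracket ℝ (fun P' => projQ P' u) fun P' => projQ P' v)
      (fun P' => projQ P' w) (point z) =
      projQ (point z) (dprojQ (point z) (dprojQ (point z) u v - dprojQ (point z) v u) w) := by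
    rw [nablaQ, fderiv_projQ, hb]
  -- The second derivatives of the projector are symmetric and cancel; the terms from
  -- differentiating the extensions of u and v cancel against the Lie bracket.
  rw [e1, e2, e3, key, key, hu', hv', ddprojQ_comm u v, dprojQ_sub]
  simp only [projQ_add, projQ_sub, projQ_projQ hz hq]
  abel

/-- The horizontal lift of the normal Jacobi operator, where `v` is the lift of the unit normal. -/
def jacobiLift {m : ℕ} (v w : Fin (m + 2) → ℂ) : Fin (m + 2) → ℂ :=
  w + (star v ⬝ᵥ w - 2 * (star w ⬝ᵥ v)) • v + (v ⬝ᵥ v) • star w - (v ⬝ᵥ w) • star v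

theorem jacobi_tangentVec {m : ℕ} {z v w : Fin (m + 2) → ℂ} (hz : IsUnitVec z)
    (hq : OnQuadric z) (hv : IsHorizontal z v) (hw : IsHorizontal z w) (hv1 : IsUnitVec v) :
    jacobi (point z) (tangentVec z v) (tangentVec z w) = tangentVec z (jacobiLift v w) := by
  have hv1' : star v ⬝ᵥ v = 1 := hv1
  rw [jacobi, curvature_eq hz hq (tangentVec_mem hz hq hw) (tangentVec_mem hz hq hv),
    dprojQ_tangentVec hz hq hv hv, dprojQ_tangentVec hz hq hw hv, projQ_sub,
    projQ_dprojQ_sndForm hz hq hw hv hv, projQ_dprojQ_sndForm hz hq hv hw hv, ← tangentVec_sub]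
  congr 1
  rw [jacobiLift, hv1', dotProduct_comm w v]
  module

theorem jacobiLift_isHorizontal {m : ℕ} {z v w : Fin (m + 2) → ℂ} (hv : IsHorizontal z v)
    (hw : IsHorizontal z w) : IsHorizontal z (jacobiLift v w) :=
  ((hw.add (hv.smul _)).add (hw.conj.smul _)).sub (hv.conj.smul _)

/-! ### Shape operators of the quadric and isotropic vectors -/

/-- As a polynomial in P, the normal projection is ρ ↦ PᵀρP + PρPᵀ, with no condition on P. -/
theorem fderiv_projNormal {m : ℕ} (ρ P X : Mat m) :
    fderiv ℝ (fun P' => projNormal P' ρ) P X =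
      Xᵀ * ρ * P + Pᵀ * ρ * X + (X * ρ * Pᵀ + P * ρ * Xᵀ) := by
  have h0 : (fun P' : Mat m => projNormal P' ρ) = fun P' => P'ᵀ * ρ * P' + P' * ρ * P'ᵀ := by
    funext P'
    simp only [projNormal, projCP, projQ]
    noncomm_ring
  have ht : ContDiff ℝ 1 (fun P' : Mat m => P'ᵀ) := contDiff_transpose
  have h1 : DifferentiableAt ℝ (fun P' : Mat m => P'ᵀ * ρ * P' + P' * ρ * P'ᵀ) P :=
    ((contDiff_mat_mul (contDiff_mat_mul ht contDiff_const) contDiff_id).add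
      (contDiff_mat_mul (contDiff_mat_mul contDiff_id contDiff_const) ht)).differentiable
        one_ne_zero P
  have h2 : HasDerivAt (fun t : ℝ =>
      (P + t • X)ᵀ * ρ * (P + t • X) + (P + t • X) * ρ * (P + t • X)ᵀ)
      (Xᵀ * ρ * P + Pᵀ * ρ * X + (X * ρ * Pᵀ + P * ρ * Xᵀ)) 0 := by
    have hl := hasDerivAt_line P X
    have hc := hasDerivAt_const (0 : ℝ) ρ
    have h := hasDerivAt_mat_add
      (hasDerivAt_mat_mul (hasDerivAt_mat_mul (hasDerivAt_transpose hl) hc) hl)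
      (hasDerivAt_mat_mul (hasDerivAt_mat_mul hl hc) (hasDerivAt_transpose hl))
    simpa using h
  rw [h0]
  exact fderiv_eq_of_line h1 h2

/-- On lifts the conjugations in 𝔄 are thus w ↦ -μ w̄. Of the four terms of the derivative, applied
to z, one is μ w̄, one vanishes, and two lie along z̄ and z and are projected away. -/
theorem shapeQ_tangentVec {m : ℕ} {z w : Fin (m + 2) → ℂ} (hz : IsUnitVec z) (hq : OnQuadric z)
    (hw : IsHorizontal z w) (μ : ℂ) :
    shapeQ (point z) (tangentVec z (μ • star z)) (tangentVec z w) =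
      tangentVec z (-(μ • star w)) := by
  have e1 : star z ⬝ᵥ z = 1 := hz
  have e2 : z ⬝ᵥ star z = 1 := by rw [dotProduct_comm, e1]
  have f3 : w ⬝ᵥ star z = 0 := by rw [dotProduct_comm]; exact hw.left
  have f4 : w ⬝ᵥ z = 0 := by rw [dotProduct_comm]; exact hw.right
  have f8 : star w ⬝ᵥ z = 0 := by rw [dotProduct_comm]; exact hw.conj.right
  set ρ := tangentVec z (μ • star z) with hρ
  set X := tangentVec z w with hX
  have hρH : ρᴴ = ρ := tangentVec_isHermitian _ _
  have hXH : Xᴴ = X := tangentVec_isHermitian _ _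
  have hPH : (point z)ᴴ = point z := point_isHermitian _
  have hPt : (point z)ᵀᴴ = (point z)ᵀ := by
    rw [Matrix.conjTranspose_transpose_eq_transpose_conjTranspose, hPH]
  have hXt : Xᵀᴴ = Xᵀ := by
    rw [Matrix.conjTranspose_transpose_eq_transpose_conjTranspose, hXH]
  have herm : (Xᵀ * ρ * point z + (point z)ᵀ * ρ * X +
      (X * ρ * (point z)ᵀ + point z * ρ * Xᵀ)).IsHermitian := by
    simp only [Matrix.IsHermitian, Matrix.conjTranspose_add, Matrix.conjTranspose_mul, hρH, hXH,
      hPH, hPt, hXt]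
    noncomm_ring
  rw [shapeQ, fderiv_projNormal, projQ_point herm, ← tangentVec_neg]
  congr 2
  have h1 : (Xᵀ * ρ * point z) *ᵥ z = μ • star w := by
    rw [← Matrix.mulVec_mulVec, ← Matrix.mulVec_mulVec, point_mulVec hz]
    simp [hρ, hX, tangentVec, Matrix.add_mulVec, Matrix.transpose_vecMulVec,
      Matrix.vecMulVec_mulVec, Matrix.vecMulVec_smul, Matrix.smul_vecMulVec, Matrix.smul_mulVec,
      Matrix.mulVec_smul, e1, e2, hq.dot, f3]
  have h2 : ((point z)ᵀ * ρ * X) *ᵥ z = (z ⬝ᵥ (ρ * X) *ᵥ z) • star z := by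
    rw [mul_assoc, ← Matrix.mulVec_mulVec]
    rw [point, Matrix.transpose_vecMulVec, Matrix.vecMulVec_mulVec, op_smul_eq_smul]
  have h3 : (X * ρ * (point z)ᵀ) *ᵥ z = 0 := by
    rw [← Matrix.mulVec_mulVec]
    simp [point, Matrix.transpose_vecMulVec, Matrix.vecMulVec_mulVec, hq.dot]
  have h4 : (point z * ρ * Xᵀ) *ᵥ z = (star z ⬝ᵥ (ρ * Xᵀ) *ᵥ z) • z := by
    rw [mul_assoc, ← Matrix.mulVec_mulVec]
    rw [point, Matrix.vecMulVec_mulVec, op_smul_eq_smul]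
  simp only [Matrix.add_mulVec, h1, h2, h3, h4, hor_add, hor_smul, hor_self hz hq,
    hor_star_self hz hq, hw.conj.hor_eq, smul_zero, add_zero, zero_add]

/-- The normal space is the complex line spanned by z̄: the horizontal part of the lift of ρ is
tangent to the quadric, hence orthogonal to itself. -/
theorem exists_unitNormalQ {m : ℕ} {z : Fin (m + 2) → ℂ} {ρ : Mat m} (hz : IsUnitVec z)
    (hq : OnQuadric z) (hρ : ρ ∈ unitNormalQ (point z)) :
    ∃ μ : ℂ, star μ * μ = 1 ∧ ρ = tangentVec z (μ • star z) := by
  obtain ⟨h1, h2, h3⟩ := hρ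
  obtain ⟨c, hc, rfl⟩ := exists_horizontal_tangentCP hz h1
  have hh := hor_isHorizontal hz hq c
  have h4 := h2 _ (tangentVec_mem hz hq hh)
  rw [metric_tangentVec hz hc hh.left, ← star_dot_swap, hh.star_dot_hor] at h4
  have h5 : star (hor z c) ⬝ᵥ hor z c = 0 := by
    apply Complex.ext
    · simpa using h4
    · exact star_dot_self_im _
  have h6 := eq_zero_of_star_dot h5
  have h7 : c = (z ⬝ᵥ c) • star z := by
    rw [hor, hc, zero_smul, sub_zero, sub_eq_zero] at h6
    exact h6
  have e2 : z ⬝ᵥ star z = 1 := by rw [dotProduct_comm]; exact hz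
  rw [metric_tangentVec hz hc hc] at h3
  refine ⟨z ⬝ᵥ c, ?_, by rw [← h7]⟩
  generalize z ⬝ᵥ c = μ at h7
  subst h7
  simp only [star_smul, star_star, smul_dotProduct, dotProduct_smul, e2, smul_eq_mul, mul_one]
    at h3
  apply Complex.ext
  · rw [mul_comm, h3]; simp
  · simp; ring

theorem star_mem_unitNormalQ {m : ℕ} {z : Fin (m + 2) → ℂ} (hz : IsUnitVec z) (hq : OnQuadric z)
    {μ : ℂ} (hμ : star μ * μ = 1) : tangentVec z (μ • star z) ∈ unitNormalQ (point z) := by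
  have e2 : z ⬝ᵥ star z = 1 := by rw [dotProduct_comm]; exact hz
  have h : star z ⬝ᵥ (μ • star z) = 0 := by simp [hq.star_dot]
  refine ⟨⟨z, _, hz, rfl, h, rfl⟩, ?_, ?_⟩
  · intro X hX
    obtain ⟨v, hv, rfl⟩ := exists_horizontal hz hX
    rw [metric_tangentVec hz h hv.left]
    simp [hv.right]
  · rw [metric_tangentVec hz h h]
    simp only [star_smul, star_star, smul_dotProduct, dotProduct_smul, e2, smul_eq_mul, mul_one,
      mul_comm μ, hμ, Complex.one_re]

theorem tangentVec_injective {m : ℕ} {z v w : Fin (m + 2) → ℂ} (hz : IsUnitVec z)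
    (hv : IsHorizontal z v) (hw : IsHorizontal z w) (h : tangentVec z v = tangentVec z w) :
    v = w := by
  rw [← tangentVec_mulVec hz hv.left, h, tangentVec_mulVec hz hw.left]

theorem dot_eq_of_conj {m : ℕ} {μ : ℂ} {w w' : Fin (m + 2) → ℂ}
    (hw : -(μ • star w) = w) : w ⬝ᵥ w' = -μ * (star w ⬝ᵥ w') := by
  conv_lhs => rw [← hw]
  simp

/-- For v = (a + ib)/√2 with a, b fixed by one conjugation, a·a = b·b and a·b = 0, so v·v = 0. -/
theorem isIsotropic_iff {m : ℕ} {z v : Fin (m + 2) → ℂ} (hz : IsUnitVec z) (hq : OnQuadric z)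
    (hv : IsHorizontal z v) (hv1 : IsUnitVec v) :
    IsIsotropic (point z) (tangentVec z v) ↔ v ⬝ᵥ v = 0 := by
  have hv1' : star v ⬝ᵥ v = 1 := hv1
  have hm : metric (tangentVec z v) (tangentVec z v) = 1 := by
    rw [metric_tangentVec hz hv.left hv.left, hv1', Complex.one_re]
  have hs : ((Real.sqrt 2)⁻¹ : ℝ) * (Real.sqrt 2)⁻¹ = 1 / 2 := by
    rw [← mul_inv, Real.mul_self_sqrt (by norm_num)]; norm_num
  set s : ℝ := (Real.sqrt 2)⁻¹
  constructor
  · rintro ⟨-, -, ρ, hρ, Z₁, hZ₁, Z₂, hZ₂, hs₁, hs₂, h11, h22, h12, heq⟩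
    obtain ⟨μ, hμ, rfl⟩ := exists_unitNormalQ hz hq hρ
    obtain ⟨a, ha, rfl⟩ := exists_horizontal hz hZ₁
    obtain ⟨b, hb, rfl⟩ := exists_horizontal hz hZ₂
    rw [shapeQ_tangentVec hz hq ha] at hs₁
    rw [shapeQ_tangentVec hz hq hb] at hs₂
    have ha' : -(μ • star a) = a :=
      tangentVec_injective hz (by simpa using (ha.conj.smul (-μ))) ha hs₁
    have hb' : -(μ • star b) = b :=
      tangentVec_injective hz (by simpa using (hb.conj.smul (-μ))) hb hs₂
    rw [metric_tangentVec hz ha.left ha.left] at h11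
    rw [metric_tangentVec hz hb.left hb.left] at h22
    rw [metric_tangentVec hz ha.left hb.left] at h12
    have k11 : star a ⬝ᵥ a = 1 := Complex.ext h11 (by simpa using star_dot_self_im a)
    have k22 : star b ⬝ᵥ b = 1 := Complex.ext h22 (by simpa using star_dot_self_im b)
    have k12 : star a ⬝ᵥ b = 0 := by
      -- Vectors fixed by w ↦ -μ w̄ with |μ| = 1 have real Hermitian products, so real orthogonality
      -- of a and b is Hermitian orthogonality.
      have h1 : star (star a ⬝ᵥ b) = star a ⬝ᵥ b := by
        have e : star a ⬝ᵥ b = (star μ * μ) * (a ⬝ᵥ star b) := by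
          conv_lhs => rw [← ha', ← hb']
          simp
          ring
        rw [hμ, one_mul, dot_star_swap] at e
        exact e.symm
      apply Complex.ext
      · simpa using h12
      · have := congrArg Complex.im h1
        simp only [Complex.star_def, Complex.conj_im, Complex.zero_im] at this ⊢
        linarith
    rw [hm, Real.sqrt_one, inv_one, one_smul, cplx_tangentVec hz hb.left, ← tangentVec_add,
      ← tangentVec_smul] at heq
    have hvv := tangentVec_injective hz hv ((ha.add (hb.smul _)).smul _) heq
    rw [hvv]
    simp only [smul_dotProduct, dotProduct_smul, add_dotProduct, dotProduct_add,
      dotProduct_comm b a, dot_eq_of_conj ha', dot_eq_of_conj hb', k11, k12, k22,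
      smul_eq_mul]
    linear_combination (-(s : ℂ) ^ 2 * μ) * Complex.I_sq
  · intro h0
    have h0' : star v ⬝ᵥ star v = 0 := by rw [Matrix.star_dotProduct_star, h0, star_zero]
    have h1' : v ⬝ᵥ star v = 1 := by rw [dotProduct_comm]; exact hv1
    have hs' : (s : ℂ) * s = 1 / 2 := by
      rw [← Complex.ofReal_mul, hs]; norm_num
    -- These are √2 Re v and √2 Im v. The normal with lift -z̄ is chosen below because its shape
    -- operator is plain conjugation on lifts.
    set a := (s : ℂ) • (v + star v) with haa
    set b := (-Complex.I * s : ℂ) • (v - star v) with hbb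
    have ha : IsHorizontal z a := (hv.add hv.conj).smul _
    have hb : IsHorizontal z b := (hv.sub hv.conj).smul _
    have sa : star a = a := by simp [haa, add_comm]
    have sb : star b = b := by simp [hbb]; module
    refine ⟨tangentVec_mem hz hq hv, ?_, tangentVec z ((-1 : ℂ) • star z),
      star_mem_unitNormalQ hz hq (by simp), tangentVec z a, tangentVec_mem hz hq ha,
      tangentVec z b, tangentVec_mem hz hq hb, ?_, ?_, ?_, ?_, ?_, ?_⟩
    · intro h
      rw [h] at hm
      simp [metric] at hm
    · rw [shapeQ_tangentVec hz hq ha, sa]; simp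
    · rw [shapeQ_tangentVec hz hq hb, sb]; simp
    · rw [metric_tangentVec hz ha.left ha.left, sa]
      have : a ⬝ᵥ a = 1 := by
        simp only [haa, smul_dotProduct, dotProduct_smul, add_dotProduct, dotProduct_add, h0, h0',
          h1', hv1', smul_eq_mul]
        linear_combination 2 * hs'
      rw [this, Complex.one_re]
    · rw [metric_tangentVec hz hb.left hb.left, sb]
      have : b ⬝ᵥ b = 1 := by
        simp only [hbb, smul_dotProduct, dotProduct_smul, sub_dotProduct, dotProduct_sub, h0, h0',
          h1', hv1', smul_eq_mul]
        linear_combination 2 * hs' - 2 * (s : ℂ) ^ 2 * Complex.I_sq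
      rw [this, Complex.one_re]
    · rw [metric_tangentVec hz ha.left hb.left, sa]
      have : a ⬝ᵥ b = 0 := by
        simp only [haa, hbb, smul_dotProduct, dotProduct_smul, add_dotProduct, dotProduct_sub, h0,
          h0', h1', hv1', smul_eq_mul]
        ring
      rw [this, Complex.zero_re]
    · rw [hm, Real.sqrt_one, inv_one, one_smul, cplx_tangentVec hz hb.left, ← tangentVec_add,
        ← tangentVec_smul]
      congr 1
      rw [haa, hbb]
      simp only [smul_add, smul_sub, smul_smul]
      have e1 : (s : ℂ) * (Complex.I * (-Complex.I * s)) = 1 / 2 := by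
        linear_combination hs' - (s : ℂ) ^ 2 * Complex.I_sq
      rw [e1, hs']
      module

/-! ### Horizontal lifts of curves -/

theorem hasDerivAt_entry {m : ℕ} {A : ℝ → Mat m} {A' : Mat m} {t : ℝ} (hA : HasDerivAt A A' t)
    (i j : Fin (m + 2)) : HasDerivAt (fun s => A s i j) (A' i j) t :=
  (LinearMap.toContinuousLinearMap (Matrix.entryLinearMap ℝ ℂ i j :
    Mat m →ₗ[ℝ] ℂ)).hasFDerivAt.comp_hasDerivAt t hA

theorem hasDerivAt_dot {m : ℕ} {a b : ℝ → Fin (m + 2) → ℂ} {a' b' : Fin (m + 2) → ℂ} {t : ℝ}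
    (ha : HasDerivAt a a' t) (hb : HasDerivAt b b' t) :
    HasDerivAt (fun s => a s ⬝ᵥ b s) (a' ⬝ᵥ b t + a t ⬝ᵥ b') t := by
  rw [hasDerivAt_pi] at ha hb
  have h := HasDerivAt.fun_sum (u := Finset.univ) fun i _ => (ha i).mul (hb i)
  simpa [dotProduct, Finset.sum_add_distrib] using h

theorem hasDerivAt_star_vec {m : ℕ} {a : ℝ → Fin (m + 2) → ℂ} {a' : Fin (m + 2) → ℂ} {t : ℝ}
    (ha : HasDerivAt a a' t) : HasDerivAt (fun s => star (a s)) (star a') t := ha.star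

theorem hasDerivAt_star_mat {m : ℕ} {A : ℝ → Mat m} {A' : Mat m} {t : ℝ}
    (hA : HasDerivAt A A' t) : HasDerivAt (fun s => (A s)ᴴ) A'ᴴ t := hA.star

theorem hasDerivAt_mulVec {m : ℕ} {A : ℝ → Mat m} {A' : Mat m} {a : ℝ → Fin (m + 2) → ℂ}
    {a' : Fin (m + 2) → ℂ} {t : ℝ} (hA : HasDerivAt A A' t) (ha : HasDerivAt a a' t) :
    HasDerivAt (fun s => A s *ᵥ a s) (A' *ᵥ a t + A t *ᵥ a') t := by
  rw [hasDerivAt_pi] at ha ⊢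
  intro i
  have h := HasDerivAt.fun_sum (u := Finset.univ) fun j _ =>
    (hasDerivAt_entry hA i j).mul (ha j)
  simpa [Matrix.mulVec, dotProduct, Finset.sum_add_distrib] using h

theorem hasDerivAt_eq_of_eventuallyEq {F : Type*} [NormedAddCommGroup F] [NormedSpace ℝ F]
    {a b : ℝ → F} {a' b' : F} {t : ℝ} (ha : HasDerivAt a a' t) (hb : HasDerivAt b b' t)
    (h : ∀ᶠ s in nhds t, a s = b s) : a' = b' :=
  ha.unique (hb.congr_of_eventuallyEq h)

theorem isHermitian_deriv {m : ℕ} {A : ℝ → Mat m} {A' : Mat m} {t : ℝ}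
    (hA : HasDerivAt A A' t) (h : ∀ᶠ s in nhds t, (A s).IsHermitian) : A'.IsHermitian :=
  hasDerivAt_eq_of_eventuallyEq (hasDerivAt_star_mat hA) hA h

theorem point_mul_self {m : ℕ} {z : Fin (m + 2) → ℂ} (hz : IsUnitVec z) :
    point z * point z = point z := by
  have hz' : star z ⬝ᵥ z = 1 := hz
  simp [point, Matrix.vecMulVec_mul_vecMulVec, hz']

/-- The relation h is the derivative of P² = P; evaluated between z and z it says 2c = c for c = ⟨z,
P'z⟩. -/
theorem tangentVec_of_idem_deriv {m : ℕ} {z : Fin (m + 2) → ℂ} {P' : Mat m} (hz : IsUnitVec z)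
    (hH : P'.IsHermitian) (h : P' * point z + point z * P' = P') :
    star z ⬝ᵥ P' *ᵥ z = 0 ∧ P' = tangentVec z (P' *ᵥ z) := by
  have hz' : star z ⬝ᵥ z = 1 := hz
  constructor
  · have h1 := congrArg (fun A : Mat m => star z ⬝ᵥ A *ᵥ z) h
    simp only [Matrix.add_mulVec, ← Matrix.mulVec_mulVec, point_mulVec hz, dotProduct_add] at h1
    have h2 : star z ⬝ᵥ point z *ᵥ P' *ᵥ z = star z ⬝ᵥ P' *ᵥ z := by
      rw [point, Matrix.vecMulVec_mulVec, op_smul_eq_smul, dotProduct_smul, hz', smul_eq_mul,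
        mul_one]
    rw [h2] at h1
    simpa using h1
  · conv_lhs => rw [← h]
    simp only [tangentVec, point, Matrix.mul_vecMulVec, Matrix.vecMulVec_mul, Matrix.star_mulVec,
      hH.eq]

theorem isUnitVec_smul {m : ℕ} {z : Fin (m + 2) → ℂ} (hz : IsUnitVec z) {c : ℂ}
    (hc : c * star c = 1) : IsUnitVec (c • z) := by
  have hz' : star z ⬝ᵥ z = 1 := hz
  simp only [IsUnitVec, star_smul, smul_dotProduct, smul_eq_mul, dotProduct_smul, hz', mul_one]
  exact hc

/-- A curve in the quadric has a lift to the unit sphere that is horizontal at time `0`. -/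
theorem exists_lift {m : ℕ} {γ : ℝ → Mat m} {P' : Mat m} {z : Fin (m + 2) → ℂ}
    (hγ : ∀ᶠ t in nhds 0, γ t ∈ quadric m) (hd : HasDerivAt γ P' 0) (hz : IsUnitVec z)
    (h0 : γ 0 = point z) :
    ∃ ζ : ℝ → Fin (m + 2) → ℂ, ζ 0 = z ∧ HasDerivAt ζ (P' *ᵥ z) 0 ∧
      (∀ᶠ t in nhds 0, IsUnitVec (ζ t) ∧ OnQuadric (ζ t) ∧ γ t = point (ζ t)) ∧
      IsHorizontal z (P' *ᵥ z) ∧ P' = tangentVec z (P' *ᵥ z) := by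
  have hz' : star z ⬝ᵥ z = 1 := hz
  have hH : P'.IsHermitian := by
    refine isHermitian_deriv hd (hγ.mono ?_)
    rintro t ⟨w, -, -, hw⟩
    rw [hw]
    exact point_isHermitian w
  have hidem : P' * point z + point z * P' = P' := by
    have h1 := hasDerivAt_mat_mul hd hd
    rw [h0] at h1
    refine hasDerivAt_eq_of_eventuallyEq h1 hd (hγ.mono ?_)
    rintro t ⟨w, hw1, -, hw⟩
    simp only [hw]
    exact point_mul_self hw1
  obtain ⟨hx, hP'⟩ := tangentVec_of_idem_deriv hz hH hidem
  have hd1 : HasDerivAt (fun t => γ t *ᵥ z) (P' *ᵥ z) 0 := by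
    simpa using hasDerivAt_mulVec hd (hasDerivAt_const 0 z)
  have hq : HasDerivAt (fun t => star z ⬝ᵥ γ t *ᵥ z) 0 0 := by
    simpa [hx] using hasDerivAt_dot (hasDerivAt_const 0 (star z)) hd1
  have hq0 : star z ⬝ᵥ γ 0 *ᵥ z = 1 := by rw [h0, point_mulVec hz, hz']
  have hqr : HasDerivAt (fun t => (star z ⬝ᵥ γ t *ᵥ z).re) 0 0 :=
    Complex.reCLM.hasFDerivAt.comp_hasDerivAt 0 hq
  -- The lift is γ(t)z divided by its norm, whose square is ⟨z, γ(t)z⟩. That square has derivative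
  -- ⟨z, P'z⟩ = 0, so normalizing leaves the velocity P'z unchanged.
  have hr : HasDerivAt (fun t => (Real.sqrt (star z ⬝ᵥ γ t *ᵥ z).re)⁻¹) 0 0 := by
    have h1 := hqr.sqrt (by simp [hq0])
    have h2 := h1.fun_inv (by simp [hq0])
    simpa using h2
  set r : ℝ → ℝ := fun t => (Real.sqrt (star z ⬝ᵥ γ t *ᵥ z).re)⁻¹ with hrdef
  have hr0 : r 0 = 1 := by simp [hrdef, hq0]
  have hpos : ∀ᶠ t in nhds (0 : ℝ), 0 < (star z ⬝ᵥ γ t *ᵥ z).re := by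
    refine hqr.continuousAt.eventually (lt_mem_nhds ?_)
    simp [hq0]
  have hζ : HasDerivAt (fun t => r t • (γ t *ᵥ z)) (P' *ᵥ z) 0 := by
    simpa [hr0] using hr.fun_smul hd1
  have hev : ∀ᶠ t in nhds 0, IsUnitVec (r t • (γ t *ᵥ z)) ∧ OnQuadric (r t • (γ t *ᵥ z)) ∧
      γ t = point (r t • (γ t *ᵥ z)) := by
    filter_upwards [hγ, hpos] with t ht htp
    obtain ⟨w, hw1, hwq, hw⟩ := ht
    have e1 : γ t *ᵥ z = (star w ⬝ᵥ z) • w := by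
      rw [hw, point, Matrix.vecMulVec_mulVec, op_smul_eq_smul]
    set c := star w ⬝ᵥ z with hc
    have e2 : star z ⬝ᵥ γ t *ᵥ z = c * star c := by
      rw [e1, dotProduct_smul, hc, star_dot_swap, smul_eq_mul]
    have e3 : r t • (γ t *ᵥ z) = ((r t : ℂ) * c) • w := by
      rw [e1, mul_smul]
      exact (algebraMap_smul ℂ (r t) _).symm
    have e4 : ((r t : ℂ) * c) * star ((r t : ℂ) * c) = 1 := by
      have h1 : (r t : ℝ) * r t * (star z ⬝ᵥ γ t *ᵥ z).re = 1 := by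
        rw [hrdef, ← mul_inv, Real.mul_self_sqrt htp.le, inv_mul_cancel₀ htp.ne']
      have h2 : (c * star c : ℂ) = ((star z ⬝ᵥ γ t *ᵥ z).re : ℂ) := by
        rw [e2, Complex.star_def, Complex.mul_conj]; simp
      have h3 : ((r t : ℂ) * r t * ((star z ⬝ᵥ γ t *ᵥ z).re : ℂ)) = 1 := by
        rw [← Complex.ofReal_mul, ← Complex.ofReal_mul, h1, Complex.ofReal_one]
      rw [star_mul', Complex.star_def, Complex.conj_ofReal, ← Complex.star_def]
      linear_combination h3 + (r t : ℂ) * r t * h2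
    rw [e3]
    exact ⟨isUnitVec_smul hw1 e4, onQuadric_smul hwq _, by rw [point_smul e4, hw]⟩
  have hζ0 : r 0 • (γ 0 *ᵥ z) = z := by rw [hr0, h0, point_mulVec hz, one_smul]
  refine ⟨fun t => r t • (γ t *ᵥ z), hζ0, hζ, hev, ⟨hx, ?_⟩, hP'⟩
  -- Differentiating ζ·ζ = 0 gives z·P'z = 0.
  have h1 := hasDerivAt_dot hζ hζ
  have h2 := hasDerivAt_eq_of_eventuallyEq h1 (hasDerivAt_const 0 (0 : ℂ))
    (hev.mono fun t ht => ht.2.1.dot)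
  rw [hζ0, dotProduct_comm (P' *ᵥ z), ← two_mul] at h2
  simpa using h2

/-- Covariant differentiation is the horizontal part of differentiating lifts: X'z and (Xζ)' differ
by Xζ', a multiple of z. -/
theorem projQ_deriv {m : ℕ} {z x : Fin (m + 2) → ℂ} {X : ℝ → Mat m} {X' : Mat m}
    {ζ : ℝ → Fin (m + 2) → ℂ} {k' : Fin (m + 2) → ℂ} (hz : IsUnitVec z) (hq : OnQuadric z)
    (hζ0 : ζ 0 = z) (hζ : HasDerivAt ζ x 0) (hx : IsHorizontal z x)
    (hX : ∀ᶠ t in nhds 0, X t ∈ tangentQ (point (ζ t))) (hd : HasDerivAt X X' 0)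
    (hk : HasDerivAt (fun t => X t *ᵥ ζ t) k' 0) :
    projQ (point z) X' = tangentVec z (hor z k') := by
  have h1 := (hasDerivAt_mulVec hd hζ).unique hk
  have hX0 := hX.self_of_nhds
  rw [hζ0] at hX0
  obtain ⟨v, hv, hXv⟩ := exists_horizontal hz hX0
  rw [projQ_point (isHermitian_deriv hd (hX.mono fun t ht => isHermitian_of_mem_tangentQ ht)),
    ← h1, hor_add, hζ0, hXv]
  have h2 : tangentVec z v *ᵥ x = (star v ⬝ᵥ x) • z := by
    simp [tangentVec, Matrix.add_mulVec, Matrix.vecMulVec_mulVec, hx.left]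
  rw [h2, hor_smul, hor_self hz hq, smul_zero, add_zero]

/-! ### Curves in the hypersurface -/

section Manifold

variable {m : ℕ} {M : Type*} [TopologicalSpace M]
  [ChartedSpace (EuclideanSpace ℝ (Fin (2 * m - 1))) M]

/-- The coordinate line through `x` with velocity `u`. -/
def chartCurve (x : M) (u : EuclideanSpace ℝ (Fin (2 * m - 1))) (t : ℝ) : M :=
  (extChartAt (𝓡 (2 * m - 1)) x).symm (extChartAt (𝓡 (2 * m - 1)) x x + t • u)

theorem chartCurve_zero (x : M) (u : EuclideanSpace ℝ (Fin (2 * m - 1))) :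
    chartCurve x u 0 = x := by
  rw [chartCurve, zero_smul, add_zero, extChartAt_to_inv]

theorem tendsto_chartCurve (x : M) (u : EuclideanSpace ℝ (Fin (2 * m - 1))) :
    Filter.Tendsto (chartCurve x u) (nhds 0) (nhds x) := by
  have h1 : Filter.Tendsto (fun t : ℝ => extChartAt (𝓡 (2 * m - 1)) x x + t • u) (nhds 0)
      (nhds (extChartAt (𝓡 (2 * m - 1)) x x)) := by
    have : Continuous (fun t : ℝ => extChartAt (𝓡 (2 * m - 1)) x x + t • u) := by fun_prop
    have h := this.tendsto 0
    rwa [zero_smul, add_zero] at h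
  have h2 := (continuousAt_extChartAt_symm (I := 𝓡 (2 * m - 1)) x).tendsto
  rw [extChartAt_to_inv] at h2
  exact h2.comp h1

theorem hasFDerivAt_chart {Y : M → Mat m} {x : M}
    (hY : MDifferentiableAt (𝓡 (2 * m - 1)) 𝓘(ℝ, Mat m) Y x) :
    HasFDerivAt (fun p => Y ((extChartAt (𝓡 (2 * m - 1)) x).symm p))
      (show EuclideanSpace ℝ (Fin (2 * m - 1)) →L[ℝ] Mat m from
        mfderiv (𝓡 (2 * m - 1)) 𝓘(ℝ, Mat m) Y x) (extChartAt (𝓡 (2 * m - 1)) x x) := by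
  have h := hY.hasMFDerivAt.2
  rw [ModelWithCorners.range_eq_univ] at h
  exact hasFDerivWithinAt_univ.1 h

theorem hasDerivAt_chartCurve {Y : M → Mat m} {x : M}
    (hY : MDifferentiableAt (𝓡 (2 * m - 1)) 𝓘(ℝ, Mat m) Y x)
    (u : TangentSpace (𝓡 (2 * m - 1)) x) :
    HasDerivAt (fun t => Y (chartCurve x u t)) (dirDeriv Y x u) 0 := by
  have h := hasFDerivAt_chart hY
  have hl : ∀ u : EuclideanSpace ℝ (Fin (2 * m - 1)),
      HasDerivAt (fun t : ℝ => extChartAt (𝓡 (2 * m - 1)) x x + t • u) u 0 := by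
    intro u
    have h1 : HasDerivAt (fun t : ℝ => t • u) ((1 : ℝ) • u) 0 :=
      (hasDerivAt_id (0 : ℝ)).smul_const u
    rw [one_smul] at h1
    exact h1.const_add _
  have h0 : ∀ u : EuclideanSpace ℝ (Fin (2 * m - 1)), extChartAt (𝓡 (2 * m - 1)) x x =
      extChartAt (𝓡 (2 * m - 1)) x x + (0 : ℝ) • u := by
    intro u
    rw [zero_smul, add_zero]
  exact HasFDerivAt.comp_hasDerivAt_of_eq (0 : ℝ) h (hl u) (h0 u)

end Manifold

/-! ### The tangent space of the hypersurface -/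

/-- The linear conditions on horizontal lifts of vectors tangent to a hypersurface. -/
def normalConditions {m : ℕ} (z v : Fin (m + 2) → ℂ) : (Fin (m + 2) → ℂ) →ₗ[ℝ] ℂ × ℂ × ℝ where
  toFun w := (star z ⬝ᵥ w, z ⬝ᵥ w, (star v ⬝ᵥ w).re)
  map_add' a b := by simp [dotProduct_add]
  map_smul' r a := by
    simp only [dotProduct_smul, RingHom.id_apply, Prod.smul_mk, Complex.smul_re]

/-- Since z, z̄, v are Hermitian orthonormal, the five real conditions are independent, and 2(m + 2)
- 5 = 2m - 1. -/
theorem finrank_ker_normalConditions {m : ℕ} {z v : Fin (m + 2) → ℂ} (hz : IsUnitVec z)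
    (hq : OnQuadric z) (hv : IsHorizontal z v) (hv1 : IsUnitVec v) :
    Module.finrank ℝ (LinearMap.ker (normalConditions z v)) = 2 * m - 1 := by
  have e1 : star z ⬝ᵥ z = 1 := hz
  have e2 : z ⬝ᵥ star z = 1 := by rw [dotProduct_comm, e1]
  have e3 : star v ⬝ᵥ v = 1 := hv1
  have f7 : star v ⬝ᵥ star z = 0 := by rw [dotProduct_comm]; exact hv.conj.left
  have f8 : star v ⬝ᵥ z = 0 := by rw [dotProduct_comm]; exact hv.conj.right
  have hsurj : Function.Surjective (normalConditions z v) := by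
    rintro ⟨a, b, c⟩
    refine ⟨a • z + b • star z + (c : ℂ) • v, ?_⟩
    simp [normalConditions, dotProduct_add, e1, e2, e3, hq.dot, hq.star_dot, hv.left, hv.right,
      f7, f8]
  have h := LinearMap.finrank_range_add_finrank_ker (normalConditions z v)
  rw [LinearMap.range_eq_top.2 hsurj, finrank_top] at h
  simp [Module.finrank_prod, Module.finrank_pi_fintype, Complex.finrank_real_complex] at h
  omega

section Manifold

variable {m : ℕ} {M : Type*} [TopologicalSpace M]
  [ChartedSpace (EuclideanSpace ℝ (Fin (2 * m - 1))) M]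

theorem IsRealHypersurface.mdifferentiableAt {f : M → Mat m} (hf : IsRealHypersurface f) (x : M) :
    MDifferentiableAt (𝓡 (2 * m - 1)) 𝓘(ℝ, Mat m) f x :=
  (hf.smooth x).mdifferentiableAt (by simp)

theorem mdifferentiableAt_of_contMDiffOn {Y : M → Mat m} {U : Set M} (hU : IsOpen U)
    (hY : ContMDiffOn (𝓡 (2 * m - 1)) 𝓘(ℝ, Mat m) ∞ Y U) {x : M} (hx : x ∈ U) :
    MDifferentiableAt (𝓡 (2 * m - 1)) 𝓘(ℝ, Mat m) Y x :=
  (hY.contMDiffAt (hU.mem_nhds hx)).mdifferentiableAt (by simp)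

theorem IsRealHypersurface.exists_rep {f : M → Mat m} (hf : IsRealHypersurface f) (x : M) :
    ∃ z, IsUnitVec z ∧ OnQuadric z ∧ f x = point z := hf.mem x

theorem IsRealHypersurface.exists_lift {f : M → Mat m} (hf : IsRealHypersurface f) {x : M}
    {z : Fin (m + 2) → ℂ} (hz : IsUnitVec z) (h0 : f x = point z)
    (u : TangentSpace (𝓡 (2 * m - 1)) x) :
    ∃ ζ : ℝ → Fin (m + 2) → ℂ, ζ 0 = z ∧ HasDerivAt ζ (dirDeriv f x u *ᵥ z) 0 ∧
      (∀ᶠ t in nhds 0, IsUnitVec (ζ t) ∧ OnQuadric (ζ t) ∧ f (chartCurve x u t) = point (ζ t)) ∧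
      IsHorizontal z (dirDeriv f x u *ᵥ z) ∧
      dirDeriv f x u = tangentVec z (dirDeriv f x u *ᵥ z) :=
  ComplexQuadric.exists_lift (Filter.Eventually.of_forall fun _ => hf.mem _)
    (hasDerivAt_chartCurve (hf.mdifferentiableAt x) u) hz
    ((congrArg f (chartCurve_zero x u)).trans h0)

theorem IsRealHypersurface.dirDeriv_mem {f : M → Mat m} (hf : IsRealHypersurface f) (x : M)
    (u : TangentSpace (𝓡 (2 * m - 1)) x) : dirDeriv f x u ∈ tangentQ (f x) := by
  obtain ⟨z, hz, hq, h0⟩ := hf.exists_rep x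
  obtain ⟨-, -, -, -, hx, he⟩ := hf.exists_lift hz h0 u
  rw [h0, he]
  exact tangentVec_mem hz hq hx

/-- The tangent space of the hypersurface is the orthogonal complement of the normal vector. -/
theorem IsRealHypersurface.exists_dirDeriv_eq {f : M → Mat m} (hf : IsRealHypersurface f)
    {x : M} {z v w : Fin (m + 2) → ℂ} (hz : IsUnitVec z) (hq : OnQuadric z) (h0 : f x = point z)
    (hv : IsHorizontal z v) (hv1 : IsUnitVec v)
    (hn : ∀ u : TangentSpace (𝓡 (2 * m - 1)) x, metric (tangentVec z v) (dirDeriv f x u) = 0)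
    (hw : IsHorizontal z w) (hvw : (star v ⬝ᵥ w).re = 0) :
    ∃ u : TangentSpace (𝓡 (2 * m - 1)) x, dirDeriv f x u = tangentVec z w := by
  let D : EuclideanSpace ℝ (Fin (2 * m - 1)) →ₗ[ℝ] Mat m :=
    show EuclideanSpace ℝ (Fin (2 * m - 1)) →ₗ[ℝ] Mat m from
      (mfderiv (𝓡 (2 * m - 1)) 𝓘(ℝ, Mat m) f x).toLinearMap
  have hD : ∀ u, D u = dirDeriv f x u := fun _ => rfl
  let L : EuclideanSpace ℝ (Fin (2 * m - 1)) →ₗ[ℝ] (Fin (m + 2) → ℂ) :=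
    { toFun := fun u => D u *ᵥ z
      map_add' := fun a b => by rw [map_add, Matrix.add_mulVec]
      map_smul' := fun r a => by rw [map_smul, Matrix.smul_mulVec, RingHom.id_apply] }
  have hL : ∀ u, IsHorizontal z (L u) ∧ D u = tangentVec z (L u) := by
    intro u
    obtain ⟨-, -, -, -, hx, he⟩ := hf.exists_lift hz h0 u
    exact ⟨hx, he⟩
  have hinj : Function.Injective L := by
    intro a b hab
    apply hf.immersion x
    have h1 : D a = D b := by rw [(hL a).2, (hL b).2, hab]
    exact h1
  have hle : LinearMap.range L ≤ LinearMap.ker (normalConditions z v) := by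
    rintro _ ⟨u, rfl⟩
    have h1 := hn u
    rw [← hD, (hL u).2, metric_tangentVec hz hv.left (hL u).1.left] at h1
    simp only [LinearMap.mem_ker, normalConditions, LinearMap.coe_mk, AddHom.coe_mk,
      (hL u).1.left, (hL u).1.right, h1, Prod.mk_zero_zero]
  -- The immersion makes the image of df a (2m - 1)-dimensional subspace of a space of the same
  -- dimension.
  have heq := Submodule.eq_of_le_of_finrank_eq hle (by
    rw [LinearMap.finrank_range_of_inj hinj, finrank_ker_normalConditions hz hq hv hv1,
      finrank_euclideanSpace_fin])
  have hmem : w ∈ LinearMap.range L := by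
    rw [heq]
    simp only [LinearMap.mem_ker, normalConditions, LinearMap.coe_mk, AddHom.coe_mk,
      hw.left, hw.right, hvw, Prod.mk_zero_zero]
  obtain ⟨u, hu⟩ := hmem
  exact ⟨u, by rw [← hD, (hL u).2, hu]⟩

end Manifold

/-! ### Differentiating orthogonality relations -/

theorem hasDerivAt_metric {m : ℕ} {A B : ℝ → Mat m} {A' B' : Mat m} {t : ℝ}
    (hA : HasDerivAt A A' t) (hB : HasDerivAt B B' t) :
    HasDerivAt (fun s => metric (A s) (B s)) (metric A' (B t) + metric (A t) B') t := by
  have h1 := hasDerivAt_mat_mul hA hB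
  have h2 : HasDerivAt (fun s => (A s * B s).trace) (A' * B t + A t * B').trace t :=
    (LinearMap.toContinuousLinearMap
      (Matrix.traceLinearMap (Fin (m + 2)) ℝ ℂ)).hasFDerivAt.comp_hasDerivAt t h1
  have h3 : HasDerivAt (fun s => (A s * B s).trace.re) (A' * B t + A t * B').trace.re t :=
    Complex.reCLM.hasFDerivAt.comp_hasDerivAt t h2
  refine (h3.const_mul (1 / 2)).congr_deriv ?_
  simp only [metric, Matrix.trace_add, Complex.add_re]
  ring

theorem metric_comm {m : ℕ} (A B : Mat m) : metric A B = metric B A := by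
  rw [metric, metric, Matrix.trace_mul_comm]

theorem exists_symm_hasDerivAt_fderiv {E F : Type*} [NormedAddCommGroup E] [NormedSpace ℝ E]
    [NormedAddCommGroup F] [NormedSpace ℝ F] {G : E → F} {p : E} (hG : ContDiffAt ℝ 2 G p) :
    ∃ B : E → E → F, (∀ a b, B a b = B b a) ∧
      ∀ a b, HasDerivAt (fun t : ℝ => fderiv ℝ G (p + t • b) a) (B b a) 0 := by
  have hs : IsSymmSndFDerivAt ℝ G p := hG.isSymmSndFDerivAt (by simp)
  have hG' : DifferentiableAt ℝ (fderiv ℝ G) p :=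
    (hG.fderiv_right (m := 1) (by norm_num)).differentiableAt one_ne_zero
  refine ⟨fun a b => fderiv ℝ (fderiv ℝ G) p a b, fun a b => hs.eq a b, fun a b => ?_⟩
  have hl : HasDerivAt (fun t : ℝ => p + t • b) b 0 := by
    simpa using ((hasDerivAt_id (0 : ℝ)).smul_const b).const_add p
  have h0 : p = p + (0 : ℝ) • b := by simp
  have := HasFDerivAt.comp_hasDerivAt_of_eq (0 : ℝ) hG'.hasFDerivAt hl h0
  exact (ContinuousLinearMap.apply ℝ F a).hasFDerivAt.comp_hasDerivAt 0 this

/-- If the one-form `⟨dG, H⟩` vanishes near `p`, then so does its exterior derivative at `p`. -/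
theorem metric_fderiv_symm {m : ℕ} {E : Type*} [NormedAddCommGroup E] [NormedSpace ℝ E]
    {G H : E → Mat m} {p : E} (hG : ContDiffAt ℝ 2 G p) (hH : DifferentiableAt ℝ H p)
    (h : ∀ᶠ y in nhds p, ∀ e, metric (fderiv ℝ G y e) (H y) = 0) (a b : E) :
    metric (fderiv ℝ G p a) (fderiv ℝ H p b) = metric (fderiv ℝ G p b) (fderiv ℝ H p a) := by
  obtain ⟨B, hB, hd⟩ := exists_symm_hasDerivAt_fderiv hG
  -- Differentiate ⟨dG(a), H⟩ = 0 in the direction b. The second derivative of G is symmetric and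
  -- drops out on exchanging a and b.
  have key : ∀ a b : E, metric (B b a) (H p) +
      metric (fderiv ℝ G p a) (fderiv ℝ H p b) = 0 := by
    intro a b
    have hl : HasDerivAt (fun t : ℝ => p + t • b) b 0 := by
      simpa using ((hasDerivAt_id (0 : ℝ)).smul_const b).const_add p
    have h0 : p = p + (0 : ℝ) • b := by simp
    have hl0 : Filter.Tendsto (fun t : ℝ => p + t • b) (nhds 0) (nhds p) := by
      simpa using hl.continuousAt.tendsto
    have h2 : HasDerivAt (fun t : ℝ => H (p + t • b)) (fderiv ℝ H p b) 0 :=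
      HasFDerivAt.comp_hasDerivAt_of_eq (0 : ℝ) hH.hasFDerivAt hl h0
    have h3 := hasDerivAt_metric (hd a b) h2
    rw [← h0] at h3
    exact hasDerivAt_eq_of_eventuallyEq h3 (hasDerivAt_const 0 (0 : ℝ))
      ((hl0.eventually h).mono fun t ht => ht a)
  have h1 := key a b
  have h2 := key b a
  rw [hB b a] at h1
  linarith

section Manifold

variable {m : ℕ} {M : Type*} [TopologicalSpace M]
  [ChartedSpace (EuclideanSpace ℝ (Fin (2 * m - 1))) M]

/-- Used twice: with G = f, H = N for the symmetry of the shape operator, and with G = N, H = JN for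
the identity behind `im_star_dot_eq`. -/
theorem metric_dirDeriv_symm [IsManifold (𝓡 (2 * m - 1)) ∞ M] {G H : M → Mat m} {U : Set M}
    (hU : IsOpen U) (hG : ContMDiffOn (𝓡 (2 * m - 1)) 𝓘(ℝ, Mat m) ∞ G U)
    (hH : ContMDiffOn (𝓡 (2 * m - 1)) 𝓘(ℝ, Mat m) ∞ H U)
    (h : ∀ y ∈ U, ∀ u : TangentSpace (𝓡 (2 * m - 1)) y, metric (dirDeriv G y u) (H y) = 0)
    {x : M} (hx : x ∈ U) (a b : TangentSpace (𝓡 (2 * m - 1)) x) :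
    metric (dirDeriv G x a) (dirDeriv H x b) = metric (dirDeriv G x b) (dirDeriv H x a) := by
  set φ := extChartAt (𝓡 (2 * m - 1)) x with hφ
  have hGd := hasFDerivAt_chart (mdifferentiableAt_of_contMDiffOn hU hG hx)
  have hHd := hasFDerivAt_chart (mdifferentiableAt_of_contMDiffOn hU hH hx)
  have hGc : ContDiffAt ℝ 2 (fun p => G (φ.symm p)) (φ x) := by
    have h1 := (contMDiffAt_iff.1 (hG.contMDiffAt (hU.mem_nhds hx))).2
    rw [ModelWithCorners.range_eq_univ] at h1
    exact (contDiffWithinAt_univ.1 h1).of_le (WithTop.coe_le_coe.2 (le_top (a := (2 : ℕ∞))))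
  have hev : ∀ᶠ p in nhds (φ x), ∀ e,
      metric (fderiv ℝ (fun p => G (φ.symm p)) p e) (H (φ.symm p)) = 0 := by
    have hc := (continuousAt_extChartAt_symm (I := 𝓡 (2 * m - 1)) x)
    have hc' : Filter.Tendsto φ.symm (nhds (φ x)) (nhds x) := by
      have := hc.tendsto
      rwa [extChartAt_to_inv] at this
    filter_upwards [hc'.eventually (hU.mem_nhds hx),
      extChartAt_target_mem_nhds (I := 𝓡 (2 * m - 1)) x] with p hp hpt e
    have h1 : MDifferentiableAt (𝓡 (2 * m - 1)) 𝓘(ℝ, Mat m) G (φ.symm p) :=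
      mdifferentiableAt_of_contMDiffOn hU hG hp
    have h2 : MDifferentiableAt 𝓘(ℝ, EuclideanSpace ℝ (Fin (2 * m - 1))) (𝓡 (2 * m - 1))
        φ.symm p := by
      have h3 := mdifferentiableWithinAt_extChartAt_symm (I := 𝓡 (2 * m - 1)) hpt
      rw [ModelWithCorners.range_eq_univ, mdifferentiableWithinAt_univ] at h3
      exact h3
    have h4 := mfderiv_comp p h1 h2
    rw [mfderiv_eq_fderiv] at h4
    have h5 : fderiv ℝ (fun p => G (φ.symm p)) p e = dirDeriv G (φ.symm p)
        (mfderiv 𝓘(ℝ, EuclideanSpace ℝ (Fin (2 * m - 1))) (𝓡 (2 * m - 1)) φ.symm p e) :=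
      congrArg (fun A => A e) h4
    rw [h5]
    exact h _ hp _
  have hfin := metric_fderiv_symm hGc hHd.differentiableAt hev a b
  rw [hGd.fderiv, hHd.fderiv] at hfin
  exact hfin

end Manifold

/-! ### The covariant derivative of the normal Jacobi operator -/

theorem hasDerivAt_jacobiLift {m : ℕ} {v w : ℝ → Fin (m + 2) → ℂ} {v' w' : Fin (m + 2) → ℂ}
    {t : ℝ} (hv : HasDerivAt v v' t) (hw : HasDerivAt w w' t) :
    HasDerivAt (fun s => jacobiLift (v s) (w s))
      (w' + ((star v' ⬝ᵥ w t + star (v t) ⬝ᵥ w' - 2 * (star w' ⬝ᵥ v t + star (w t) ⬝ᵥ v')) • v t +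
          (star (v t) ⬝ᵥ w t - 2 * (star (w t) ⬝ᵥ v t)) • v') +
        ((v' ⬝ᵥ v t + v t ⬝ᵥ v') • star (w t) + (v t ⬝ᵥ v t) • star w') -
        ((v' ⬝ᵥ w t + v t ⬝ᵥ w') • star (v t) + (v t ⬝ᵥ w t) • star v')) t := by
  have hv' := hasDerivAt_star_vec hv
  have hw' := hasDerivAt_star_vec hw
  have h1 := (hasDerivAt_dot hv' hw).fun_sub ((hasDerivAt_dot hw' hv).const_mul (2 : ℂ))
  have h := ((hw.fun_add (h1.fun_smul hv)).fun_add ((hasDerivAt_dot hv hv).fun_smul hw')).fun_sub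
    ((hasDerivAt_dot hv hw).fun_smul hv')
  refine HasDerivAt.congr_deriv (f := fun s => jacobiLift (v s) (w s)) h ?_
  abel

/-- Replacing v by e^{iθ}v multiplies (v·v)w̄ and ⟨w,v⟩v by e^{2iθ} and fixes ⟨v,w⟩v and (v·w)v̄.
This accounts for both correction terms, with their factors 2 and 4 = 2·2. -/
theorem hor_jacobiLift_deriv {m : ℕ} {z v w v' w' : Fin (m + 2) → ℂ} {α : ℝ}
    (hv : IsHorizontal z v) (hw : IsHorizontal z w) (hv' : hor z v' = (α * Complex.I) • v) :
    hor z (w' + ((star v' ⬝ᵥ w + star v ⬝ᵥ w' - 2 * (star w' ⬝ᵥ v + star w ⬝ᵥ v')) • v +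
          (star v ⬝ᵥ w - 2 * (star w ⬝ᵥ v)) • v') +
        ((v' ⬝ᵥ v + v ⬝ᵥ v') • star w + (v ⬝ᵥ v) • star w') -
        ((v' ⬝ᵥ w + v ⬝ᵥ w') • star v + (v ⬝ᵥ w) • star v')) =
      jacobiLift v (hor z w') + (2 * α * Complex.I * (v ⬝ᵥ v)) • star w
        - (4 * α * Complex.I * (star w ⬝ᵥ v)) • v := by
  have e1 : star w ⬝ᵥ v' = α * Complex.I * (star w ⬝ᵥ v) := by
    rw [hw.star_dot_hor, hv', dotProduct_smul, smul_eq_mul]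
  have e2 : star v' ⬝ᵥ w = -(α * Complex.I) * (star v ⬝ᵥ w) := by
    rw [← star_dot_swap, e1, star_mul', star_dot_swap]
    simp
  have e3 : v ⬝ᵥ v' = α * Complex.I * (v ⬝ᵥ v) := by
    rw [hv.dot_hor, hv', dotProduct_smul, smul_eq_mul]
  have e4 : v' ⬝ᵥ w = α * Complex.I * (v ⬝ᵥ w) := by
    rw [dotProduct_comm, hw.dot_hor, hv', dotProduct_smul, smul_eq_mul, dotProduct_comm]
  have e5 : star w' ⬝ᵥ v = star (hor z w') ⬝ᵥ v := by
    rw [← star_dot_swap, hv.star_dot_hor, star_dot_swap]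
  have e6 : star ((α * Complex.I) • v) = (-(α * Complex.I)) • star v := by
    rw [star_smul]
    simp
  rw [dotProduct_comm v' v, e1, e2, e3, e4, e5, hv.star_dot_hor w', hv.dot_hor w']
  simp only [hor_add, hor_sub, hor_smul, hor_star, hv', hv.hor_eq, hw.hor_eq, e6, jacobiLift]
  module

theorem re_star_dot_jacobiLift {m : ℕ} {v w : Fin (m + 2) → ℂ} (hv1 : IsUnitVec v) :
    (star (jacobiLift v w) ⬝ᵥ v).re = 0 := by
  have hv1' : star v ⬝ᵥ v = 1 := hv1
  have h1 : star v ⬝ᵥ star v = star (v ⬝ᵥ v) := Matrix.star_dotProduct_star v v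
  have h2 : star v ⬝ᵥ star w = star (v ⬝ᵥ w) := by rw [Matrix.star_dotProduct_star, dotProduct_comm]
  have h3 : star v ⬝ᵥ w = star (star w ⬝ᵥ v) := (star_dot_swap w v).symm
  rw [← star_dot_swap]
  simp only [jacobiLift, dotProduct_add, dotProduct_sub, dotProduct_smul, hv1', h1, h2, h3,
    smul_eq_mul]
  simp
  ring

/-- Because R̄_N N = 0, the Jacobi operator does not distinguish ∇ from ∇̄. -/
theorem jacobiLift_sub_smul {m : ℕ} {v w : Fin (m + 2) → ℂ} (hv1 : IsUnitVec v) (r : ℝ) :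
    jacobiLift v (w - (r : ℂ) • v) = jacobiLift v w := by
  have hv1' : star v ⬝ᵥ v = 1 := hv1
  simp only [jacobiLift, star_sub, star_smul, sub_dotProduct, dotProduct_sub, smul_dotProduct,
    dotProduct_smul, hv1', smul_eq_mul, Complex.star_def, Complex.conj_ofReal]
  module

section Manifold

variable {m : ℕ} {M : Type*} [TopologicalSpace M]
  [ChartedSpace (EuclideanSpace ℝ (Fin (2 * m - 1))) M]

theorem IsUnitNormal.exists_rep {f N : M → Mat m} {U : Set M} (hN : IsUnitNormal f U N) {x : M}
    (hx : x ∈ U) {z : Fin (m + 2) → ℂ} (hz : IsUnitVec z) (h0 : f x = point z) :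
    ∃ v, IsHorizontal z v ∧ IsUnitVec v ∧ N x = tangentVec z v ∧
      reeb f N x = tangentVec z (-(Complex.I • v)) ∧
      ∀ u : TangentSpace (𝓡 (2 * m - 1)) x, metric (tangentVec z v) (dirDeriv f x u) = 0 := by
  have h1 := hN.tangent x hx
  rw [h0] at h1
  obtain ⟨v, hv, hNv⟩ := exists_horizontal hz h1
  have h2 := hN.unit x hx
  rw [hNv, metric_tangentVec hz hv.left hv.left] at h2
  refine ⟨v, hv, Complex.ext h2 (by simpa using star_dot_self_im v), hNv, ?_, ?_⟩
  · rw [reeb, h0, hNv, cplx_tangentVec hz hv.left, tangentVec_neg]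
  · intro u
    rw [← hNv]
    exact hN.normal x hx u

theorem IsRealHypersurface.exists_reeb {f N : M → Mat m} {U : Set M} (hf : IsRealHypersurface f)
    (hN : IsUnitNormal f U N) {x : M} (hx : x ∈ U) :
    ∃ u : TangentSpace (𝓡 (2 * m - 1)) x, dirDeriv f x u = reeb f N x := by
  obtain ⟨z, hz, hq, h0⟩ := hf.exists_rep x
  obtain ⟨v, hv, hv1, -, hr, hn⟩ := hN.exists_rep hx hz h0
  rw [hr]
  refine hf.exists_dirDeriv_eq hz hq h0 hv hv1 hn (by simpa using hv.smul (-Complex.I)) ?_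
  have hv1' : star v ⬝ᵥ v = 1 := hv1
  simp [hv1']

theorem nablaBar_eq {f X : M → Mat m} {U : Set M} (hU : IsOpen U) {x : M} (hx : x ∈ U)
    (hX : ∀ y ∈ U, X y ∈ tangentQ (f y))
    (hd : MDifferentiableAt (𝓡 (2 * m - 1)) 𝓘(ℝ, Mat m) X x)
    {z : Fin (m + 2) → ℂ} (hz : IsUnitVec z) (hq : OnQuadric z) (h0 : f x = point z)
    {u : TangentSpace (𝓡 (2 * m - 1)) x} {ζ : ℝ → Fin (m + 2) → ℂ} {ξ k' : Fin (m + 2) → ℂ}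
    (hζ0 : ζ 0 = z) (hζ : HasDerivAt ζ ξ 0) (hξ : IsHorizontal z ξ)
    (hp : ∀ᶠ t in nhds 0, f (chartCurve x u t) = point (ζ t))
    (hk : HasDerivAt (fun t => X (chartCurve x u t) *ᵥ ζ t) k' 0) :
    nablaBar f X x u = tangentVec z (hor z k') := by
  rw [nablaBar, h0]
  refine projQ_deriv (X := fun t => X (chartCurve x u t)) hz hq hζ0 hζ hξ ?_
    (hasDerivAt_chartCurve hd u) hk
  filter_upwards [hp, (tendsto_chartCurve x u).eventually (hU.mem_nhds hx)] with t ht htU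
  rw [← ht]
  exact hX _ htU

theorem nabla_eq {f N X : M → Mat m} {x : M} {z v k : Fin (m + 2) → ℂ} (hz : IsUnitVec z)
    {u : TangentSpace (𝓡 (2 * m - 1)) x} (hv : IsHorizontal z v) (hk : IsHorizontal z k)
    (hN : N x = tangentVec z v) (hX : nablaBar f X x u = tangentVec z k) :
    nabla f N X x u = tangentVec z (k - ((star k ⬝ᵥ v).re : ℂ) • v) := by
  rw [nabla, hX, hN, metric_tangentVec hz hk.left hv.left, tangentVec_sub, tangentVec_smul]

/-- The right side is polynomial in all variables, which yields differentiability of R̄_N Y along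
the hypersurface. -/
theorem jacobi_eq_poly {P Z Y : Mat m} (hP : P ∈ quadric m) (hZ : Z ∈ tangentQ P)
    (hY : Y ∈ tangentQ P) :
    jacobi P Z Y = projQ P (dprojQ P Y (dprojQ P Z Z) - dprojQ P Z (dprojQ P Y Z)) := by
  obtain ⟨z, hz, hq, rfl⟩ := hP
  exact curvature_eq hz hq hY hZ Z

theorem mdifferentiableAt_jacobi {f N Y : M → Mat m} {U : Set M} (hU : IsOpen U) {x : M}
    (hx : x ∈ U) (hq : ∀ y, f y ∈ quadric m) (hNt : ∀ y ∈ U, N y ∈ tangentQ (f y))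
    (hYt : ∀ y ∈ U, Y y ∈ tangentQ (f y))
    (hf : MDifferentiableAt (𝓡 (2 * m - 1)) 𝓘(ℝ, Mat m) f x)
    (hN : MDifferentiableAt (𝓡 (2 * m - 1)) 𝓘(ℝ, Mat m) N x)
    (hY : MDifferentiableAt (𝓡 (2 * m - 1)) 𝓘(ℝ, Mat m) Y x) :
    MDifferentiableAt (𝓡 (2 * m - 1)) 𝓘(ℝ, Mat m) (fun y => jacobi (f y) (N y) (Y y)) x := by
  have h1 : ContDiff ℝ 1 (fun p : Mat m × Mat m × Mat m => p.1) := contDiff_fst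
  have h2 : ContDiff ℝ 1 (fun p : Mat m × Mat m × Mat m => p.2.1) := contDiff_fst.comp contDiff_snd
  have h3 : ContDiff ℝ 1 (fun p : Mat m × Mat m × Mat m => p.2.2) := contDiff_snd.comp contDiff_snd
  have h4 := contDiff_projQ h1 (ContDiff.sub
    (contDiff_dprojQ h1 h3 (contDiff_dprojQ h1 h2 h2))
    (contDiff_dprojQ h1 h2 (contDiff_dprojQ h1 h3 h2)))
  have h5 := (h4.differentiable one_ne_zero).differentiableAt.mdifferentiableAt.comp x
    (hf.prodMk_space (hN.prodMk_space hY))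
  refine h5.congr_of_eventuallyEq ?_
  filter_upwards [hU.mem_nhds hx] with y hy
  exact jacobi_eq_poly (hq y) (hNt y hy) (hYt y hy)

theorem IsTangentField.mem {f Y : M → Mat m} {U : Set M} (hY : IsTangentField f U Y)
    (hf : IsRealHypersurface f) {y : M} (hy : y ∈ U) : Y y ∈ tangentQ (f y) := by
  obtain ⟨u, hu⟩ := hY.tangent y hy
  rw [← hu]
  exact hf.dirDeriv_mem y u

/-- The Reeb derivative of the normal Jacobi operator of a Hopf hypersurface. -/
theorem nablaNormalJacobi_eq {f N Y : M → Mat m} {U : Set M} (hf : IsRealHypersurface f)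
    (hN : IsUnitNormal f U N) (hY : IsTangentField f U Y) {x : M} (hx : x ∈ U)
    {z v w : Fin (m + 2) → ℂ} (hz : IsUnitVec z) (hq : OnQuadric z) (h0 : f x = point z)
    (hv : IsHorizontal z v) (hv1 : IsUnitVec v) (hNv : N x = tangentVec z v)
    (hw : IsHorizontal z w) (hYw : Y x = tangentVec z w)
    {u : TangentSpace (𝓡 (2 * m - 1)) x} {α : ℝ}
    (hα : shape f N x u = α • reeb f N x) :
    nablaNormalJacobi f N Y x u = tangentVec z ((2 * α * Complex.I * (v ⬝ᵥ v)) • star w -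
      ((star ((2 * α * Complex.I * (v ⬝ᵥ v)) • star w) ⬝ᵥ v).re : ℂ) • v) := by
  have hv1' : star v ⬝ᵥ v = 1 := hv1
  have hreeb : reeb f N x = tangentVec z (-(Complex.I • v)) := by
    rw [reeb, h0, hNv, cplx_tangentVec hz hv.left, tangentVec_neg]
  obtain ⟨ζ, hζ0, hζ, hev, hξ, hξe⟩ := hf.exists_lift hz h0 u
  have hp : ∀ᶠ t in nhds 0, f (chartCurve x u t) = point (ζ t) := hev.mono fun t ht => ht.2.2
  have hUev : ∀ᶠ t in nhds 0, chartCurve x u t ∈ U :=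
    (tendsto_chartCurve x u).eventually (hN.isOpen.mem_nhds hx)
  have hYt : ∀ y ∈ U, Y y ∈ tangentQ (f y) := fun y hy => hY.mem hf hy
  have hNd := mdifferentiableAt_of_contMDiffOn hN.isOpen hN.smooth hx
  have hYd := mdifferentiableAt_of_contMDiffOn hN.isOpen hY.smooth hx
  have hKd := mdifferentiableAt_jacobi hN.isOpen hx hf.mem hN.tangent hYt
    (hf.mdifferentiableAt x) hNd hYd
  have hvd := hasDerivAt_mulVec (hasDerivAt_chartCurve hNd u) hζ
  have hwd := hasDerivAt_mulVec (hasDerivAt_chartCurve hYd u) hζ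
  have hv0 : N (chartCurve x u 0) *ᵥ ζ 0 = v := by
    rw [hζ0, congrArg N (chartCurve_zero x u), hNv, tangentVec_mulVec hz hv.left]
  have hw0 : Y (chartCurve x u 0) *ᵥ ζ 0 = w := by
    rw [hζ0, congrArg Y (chartCurve_zero x u), hYw, tangentVec_mulVec hz hw.left]
  generalize dirDeriv N x u *ᵥ ζ 0 + N (chartCurve x u 0) *ᵥ (dirDeriv f x u *ᵥ z) = v' at hvd
  generalize dirDeriv Y x u *ᵥ ζ 0 + Y (chartCurve x u 0) *ᵥ (dirDeriv f x u *ᵥ z) = w' at hwd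
  have hkd0 := hasDerivAt_jacobiLift hvd hwd
  rw [hv0, hw0] at hkd0
  -- Near 0 the lift of R̄_N Y along the curve is `jacobiLift` of the lifts of N and Y.
  have hkd := hkd0.congr_of_eventuallyEq
    (f₁ := fun t => jacobi (f (chartCurve x u t)) (N (chartCurve x u t)) (Y (chartCurve x u t))
      *ᵥ ζ t) (by
    filter_upwards [hev, hUev] with t ht htU
    obtain ⟨ht1, ht2, ht3⟩ := ht
    have h1 := hN.tangent _ htU
    have h2 := hYt _ htU
    have h3 := hN.unit _ htU
    rw [ht3] at h1 h2
    obtain ⟨a, ha, hNa⟩ := exists_horizontal ht1 h1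
    obtain ⟨b, hb, hYb⟩ := exists_horizontal ht1 h2
    rw [hNa, metric_tangentVec ht1 ha.left ha.left] at h3
    have ha1 : IsUnitVec a := Complex.ext h3 (by simpa using star_dot_self_im a)
    rw [ht3, hNa, hYb, jacobi_tangentVec ht1 ht2 ha hb ha1,
      tangentVec_mulVec ht1 (jacobiLift_isHorizontal ha hb).left, tangentVec_mulVec ht1 ha.left,
      tangentVec_mulVec ht1 hb.left])
  have hKt : ∀ y ∈ U, jacobi (f y) (N y) (Y y) ∈ tangentQ (f y) := by
    intro y hy
    obtain ⟨z', hz', hq', h0'⟩ := hf.exists_rep y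
    obtain ⟨a, ha, ha1, hNa, -, -⟩ := hN.exists_rep hy hz' h0'
    have h2 := hYt y hy
    rw [h0'] at h2
    obtain ⟨b, hb, hYb⟩ := exists_horizontal hz' h2
    rw [h0', hNa, hYb, jacobi_tangentVec hz' hq' ha hb ha1]
    exact tangentVec_mem hz' hq' (jacobiLift_isHorizontal ha hb)
  have hNb := nablaBar_eq hN.isOpen hx hN.tangent hNd hz hq h0 hζ0 hζ hξ hp hvd
  have hYb := nablaBar_eq hN.isOpen hx hYt hYd hz hq h0 hζ0 hζ hξ hp hwd
  have hKb := nablaBar_eq hN.isOpen hx hKt hKd hz hq h0 hζ0 hζ hξ hp hkd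
  have hv' : hor z v' = (α * Complex.I) • v := by
    rw [shape, hNb, hreeb, ← tangentVec_smul, ← tangentVec_neg] at hα
    have h1 := tangentVec_injective hz
      (by simpa using (hor_isHorizontal hz hq v').smul (-1))
      (by simpa using (hv.smul (-Complex.I)).smul (α : ℂ)) hα
    rw [neg_eq_iff_eq_neg] at h1
    rw [h1]
    module
  have hw'h := hor_isHorizontal hz hq w'
  have hvw : (star w ⬝ᵥ v).re = 0 := by
    obtain ⟨u', hu'⟩ := hY.tangent x hx
    have h1 := hN.normal x hx u'
    rw [hu', hYw, hNv, metric_comm, metric_tangentVec hz hw.left hv.left] at h1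
    exact h1
  rw [hor_jacobiLift_deriv hv hw hv'] at hKb
  set s := (2 * α * Complex.I * (v ⬝ᵥ v)) • star w with hs
  have hsh : IsHorizontal z s := hw.conj.smul _
  -- Y is tangent, so ⟨w,v⟩ is imaginary and this coefficient of v is real: the term is normal to
  -- the hypersurface and disappears on projecting.
  have hc : 4 * α * Complex.I * (star w ⬝ᵥ v) = ((-4 * α * (star w ⬝ᵥ v).im : ℝ) : ℂ) := by
    apply Complex.ext
    · simp
    · simp [hvw]
  rw [hc] at hKb
  have hJh := jacobiLift_isHorizontal hv hw'h
  have hκ : IsHorizontal z (jacobiLift v (hor z w') + s -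
      ((-4 * α * (star w ⬝ᵥ v).im : ℝ) : ℂ) • v) := (hJh.add hsh).sub (hv.smul _)
  rw [nablaNormalJacobi, nabla_eq hz hv hκ hNv hKb, nabla_eq hz hv hw'h hNv hYb, h0, hNv,
    jacobi_tangentVec hz hq hv (hw'h.sub (hv.smul _)) hv1, jacobiLift_sub_smul hv1,
    ← tangentVec_sub]
  congr 1
  have hre : (star (jacobiLift v (hor z w') + s -
      ((-4 * α * (star w ⬝ᵥ v).im : ℝ) : ℂ) • v) ⬝ᵥ v).re =
      (star s ⬝ᵥ v).re - (-4 * α * (star w ⬝ᵥ v).im) := by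
    rw [star_sub, star_add, star_smul _ v, sub_dotProduct, add_dotProduct, smul_dotProduct _ _ v,
      hv1']
    simp only [Complex.sub_re, Complex.add_re, re_star_dot_jacobiLift hv1, zero_add, smul_eq_mul,
      mul_one, Complex.star_def, Complex.conj_ofReal, Complex.ofReal_re]
  rw [hre]
  push_cast
  module

end Manifold

/-! ### Hopf hypersurfaces with vanishing principal curvature of the Reeb vector field -/

/-- A nonzero horizontal vector orthogonal to `v` and `v̄`. -/
theorem exists_horizontal_orthogonal {m : ℕ} (hm : 3 ≤ m) (z v : Fin (m + 2) → ℂ) :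
    ∃ w, w ≠ 0 ∧ IsHorizontal z w ∧ star v ⬝ᵥ w = 0 ∧ v ⬝ᵥ w = 0 := by
  let A : Matrix (Fin 4) (Fin (m + 2)) ℂ := ![star z, z, star v, v]
  have h : LinearMap.ker A.mulVecLin ≠ ⊥ :=
    -- Four complex equations in m + 2 unknowns: m ≥ 3 gives 4 < m + 2.
    LinearMap.ker_ne_bot_of_finrank_lt (by simp; omega)
  obtain ⟨w, hw, hw0⟩ := Submodule.exists_mem_ne_zero_of_ne_bot h
  have hw' : A *ᵥ w = 0 := hw
  exact ⟨w, hw0, ⟨congrFun hw' 0, congrFun hw' 1⟩, congrFun hw' 2, congrFun hw' 3⟩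

theorem hasDerivAt_vecMulVec {m : ℕ} {a b : ℝ → Fin (m + 2) → ℂ} {a' b' : Fin (m + 2) → ℂ} {t : ℝ}
    (ha : HasDerivAt a a' t) (hb : HasDerivAt b b' t) :
    HasDerivAt (fun s => (Matrix.vecMulVec (a s) (b s) : Mat m))
      (Matrix.vecMulVec a' (b t) + Matrix.vecMulVec (a t) b') t := by
  rw [hasDerivAt_pi] at ha hb
  have h : HasDerivAt (fun s i j => a s i * b s j) (fun i j => a' i * b t j + a t i * b' j) t :=
    hasDerivAt_pi.2 fun i => hasDerivAt_pi.2 fun j => (ha i).mul (hb j)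
  exact h

theorem hasDerivAt_tangentVec {m : ℕ} {ζ v : ℝ → Fin (m + 2) → ℂ} {x v' : Fin (m + 2) → ℂ} {t : ℝ}
    (hζ : HasDerivAt ζ x t) (hv : HasDerivAt v v' t) :
    HasDerivAt (fun s => tangentVec (ζ s) (v s)) (tangentVec (ζ t) v' + tangentVec x (v t)) t := by
  have h := hasDerivAt_mat_add (hasDerivAt_vecMulVec hv (hasDerivAt_star_vec hζ))
    (hasDerivAt_vecMulVec hζ (hasDerivAt_star_vec hv))
  refine HasDerivAt.congr_deriv (f := fun s => tangentVec (ζ s) (v s)) h ?_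
  simp only [tangentVec]
  abel

/-- This evaluates ⟨dN(a), d(JN)(b)⟩ on lifts. The two product terms are symmetric in the indices
and the other two antisymmetric, so only the latter survive in the exterior derivative. -/
theorem metric_tangentVec_add {m : ℕ} {z v v₁ v₂ x₁ x₂ : Fin (m + 2) → ℂ} (hz : IsUnitVec z)
    (hv : star z ⬝ᵥ v = 0) (hv1 : IsUnitVec v) (hx₁ : star z ⬝ᵥ x₁ = 0)
    (hx₂ : star z ⬝ᵥ x₂ = 0) :
    metric (tangentVec z v₁ + tangentVec x₁ v)
        (tangentVec z (Complex.I • v₂) + tangentVec x₂ (Complex.I • v)) =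
      -((star z ⬝ᵥ v₁) * (star z ⬝ᵥ v₂)).im - (star v₁ ⬝ᵥ v₂).im
        - ((star x₁ ⬝ᵥ v) * (star x₂ ⬝ᵥ v)).im + (star x₁ ⬝ᵥ x₂).im := by
  have e1 : star z ⬝ᵥ z = 1 := hz
  have e2 : star v ⬝ᵥ v = 1 := hv1
  have e3 := star_dot_symm hv
  have e4 := star_dot_symm hx₁
  have e5 := star_dot_symm hx₂
  have c1 : star v₁ ⬝ᵥ z = star (star z ⬝ᵥ v₁) := (star_dot_swap z v₁).symm
  have c2 : star v₂ ⬝ᵥ z = star (star z ⬝ᵥ v₂) := (star_dot_swap z v₂).symm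
  have c3 : star v₂ ⬝ᵥ v₁ = star (star v₁ ⬝ᵥ v₂) := (star_dot_swap v₁ v₂).symm
  have c4 : star x₂ ⬝ᵥ x₁ = star (star x₁ ⬝ᵥ x₂) := (star_dot_swap x₁ x₂).symm
  have c5 : star v ⬝ᵥ x₁ = star (star x₁ ⬝ᵥ v) := (star_dot_swap x₁ v).symm
  have c6 : star v ⬝ᵥ x₂ = star (star x₂ ⬝ᵥ v) := (star_dot_swap x₂ v).symm
  simp only [metric, tangentVec, add_mul, mul_add, Matrix.vecMulVec_mul_vecMulVec, star_smul,
    Matrix.trace_add, Matrix.trace_vecMulVec, dotProduct_smul, hv, hx₁, hx₂,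
    dotProduct_comm z (star _), dotProduct_comm v (star _), dotProduct_comm v₁ (star _),
    dotProduct_comm x₁ (star _), e1, e2, e3, e4, e5, c1, c2, c3, c4, c5, c6, smul_eq_mul]
  simp
  ring

theorem contDiff_metric {m : ℕ} {n : ℕ∞ω} {E : Type*} [NormedAddCommGroup E] [NormedSpace ℝ E]
    {f g : E → Mat m} (hf : ContDiff ℝ n f) (hg : ContDiff ℝ n g) :
    ContDiff ℝ n (fun p => metric (f p) (g p)) := by
  have h1 := contDiff_mat_mul hf hg
  have h2 : ContDiff ℝ n (fun p => (f p * g p).trace) :=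
    (LinearMap.toContinuousLinearMap
      (Matrix.traceLinearMap (Fin (m + 2)) ℝ ℂ)).contDiff.comp h1
  exact contDiff_const.mul (Complex.reCLM.contDiff.comp h2)

theorem contDiff_cplx {m : ℕ} {n : ℕ∞ω} {E : Type*} [NormedAddCommGroup E] [NormedSpace ℝ E]
    {f g : E → Mat m} (hf : ContDiff ℝ n f) (hg : ContDiff ℝ n g) :
    ContDiff ℝ n (fun p => cplx (f p) (g p)) := by
  have h1 : ContDiff ℝ n (fun p => g p * f p - f p * g p) :=
    ContDiff.sub (contDiff_mat_mul hg hf) (contDiff_mat_mul hf hg)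
  have h2 := contDiff_mat_mul (contDiff_const (c := (Complex.I • 1 : Mat m))) h1
  simpa only [smul_mul_assoc, one_mul, cplx] using h2

theorem contDiff_sub_metric_smul {m : ℕ} {n : ℕ∞ω} {E : Type*} [NormedAddCommGroup E]
    [NormedSpace ℝ E] {f g : E → Mat m} (hf : ContDiff ℝ n f) (hg : ContDiff ℝ n g) :
    ContDiff ℝ n (fun p => f p - metric (f p) (g p) • g p) :=
  hf.sub ((contDiff_metric hf hg).smul hg)

section Manifold

variable {m : ℕ} {M : Type*} [TopologicalSpace M]
  [ChartedSpace (EuclideanSpace ℝ (Fin (2 * m - 1))) M]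

theorem IsUnitNormal.mono {f N : M → Mat m} {U V : Set M} (h : IsUnitNormal f U N) (hV : IsOpen V)
    (hVU : V ⊆ U) : IsUnitNormal f V N :=
  ⟨hV, h.smooth.mono hVU, fun x hx => h.tangent x (hVU hx), fun x hx => h.normal x (hVU hx),
    fun x hx => h.unit x (hVU hx)⟩

theorem contMDiffOn_cplx {f N : M → Mat m} {U : Set M} (hf : IsRealHypersurface f)
    (hN : IsUnitNormal f U N) :
    ContMDiffOn (𝓡 (2 * m - 1)) 𝓘(ℝ, Mat m) ∞ (fun y => cplx (f y) (N y)) U := by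
  have h1 : ContDiff ℝ ∞ (fun p : Mat m × Mat m => p.1) := contDiff_fst
  have h2 : ContDiff ℝ ∞ (fun p : Mat m × Mat m => p.2) := contDiff_snd
  have h3 := (contDiff_cplx h1 h2).contMDiff.comp_contMDiffOn
    (hf.smooth.contMDiffOn.prodMk_space hN.smooth)
  exact h3

theorem metric_dirDeriv_normal_symm [IsManifold (𝓡 (2 * m - 1)) ∞ M] {f N : M → Mat m} {U : Set M}
    (hf : IsRealHypersurface f) (hN : IsUnitNormal f U N) {x : M} (hx : x ∈ U)
    (a b : TangentSpace (𝓡 (2 * m - 1)) x) :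
    metric (dirDeriv f x a) (dirDeriv N x b) = metric (dirDeriv f x b) (dirDeriv N x a) :=
  metric_dirDeriv_symm hN.isOpen hf.smooth.contMDiffOn hN.smooth
    (fun y hy u => by rw [metric_comm]; exact hN.normal y hy u) hx a b

/-- If `S ξ = 0` then `⟨S X, ξ⟩ = 0` for all tangent vectors `X`. -/
theorem metric_dirDeriv_normal_cplx [IsManifold (𝓡 (2 * m - 1)) ∞ M] {f N : M → Mat m} {U : Set M}
    (hf : IsRealHypersurface f) (hN : IsUnitNormal f U N) {x : M} (hx : x ∈ U)
    {u : TangentSpace (𝓡 (2 * m - 1)) x} (hu : dirDeriv f x u = reeb f N x)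
    (hS : nablaBar f N x u = 0) (a : TangentSpace (𝓡 (2 * m - 1)) x) :
    metric (dirDeriv N x a) (cplx (f x) (N x)) = 0 := by
  have h1 := metric_dirDeriv_normal_symm hf hN hx a u
  have h2 := metric_sub_projQ (X := dirDeriv N x u) (hf.dirDeriv_mem x a)
  have h3 : projQ (f x) (dirDeriv N x u) = 0 := hS
  rw [h3, sub_zero, metric_comm, h1, hu, reeb, metric_comm] at h2
  simpa [metric] using h2

/-- First-order data of a hypersurface and its unit normal in the direction `u`, in terms of
horizontal lifts: `ξ` and `v'` are the derivatives of the lifts of `f` and `N`. -/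
structure IsLiftDeriv (f N : M → Mat m) (x : M) (z v : Fin (m + 2) → ℂ)
    (u : TangentSpace (𝓡 (2 * m - 1)) x) (ξ v' : Fin (m + 2) → ℂ) : Prop where
  horizontal : IsHorizontal z ξ
  dirDeriv_eq : dirDeriv f x u = tangentVec z ξ
  dirDeriv_normal : dirDeriv N x u = tangentVec z v' + tangentVec ξ v
  dirDeriv_cplx : dirDeriv (fun y => cplx (f y) (N y)) x u =
    tangentVec z (Complex.I • v') + tangentVec ξ (Complex.I • v)
  nablaBar_eq : nablaBar f N x u = tangentVec z (hor z v')
  star_dot_left : star z ⬝ᵥ v' = -(star ξ ⬝ᵥ v)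
  dot_left : z ⬝ᵥ v' = -(ξ ⬝ᵥ v)
  re_star_dot : (star v ⬝ᵥ v').re = 0
  /-- If `v = (v · v) v̄` holds near `x`, it can be differentiated. -/
  deriv_conj : (∀ᶠ y in nhds x, ∀ z v, IsUnitVec z → f y = point z → IsHorizontal z v →
    N y = tangentVec z v → v = (v ⬝ᵥ v) • star v) →
    v' = (v ⬝ᵥ v) • star v' + (2 * (v ⬝ᵥ v')) • star v

theorem exists_isLiftDeriv {f N : M → Mat m} {U : Set M} (hf : IsRealHypersurface f)
    (hN : IsUnitNormal f U N) {x : M} (hx : x ∈ U) {z v : Fin (m + 2) → ℂ} (hz : IsUnitVec z)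
    (hq : OnQuadric z) (h0 : f x = point z) (hv : IsHorizontal z v) (hNv : N x = tangentVec z v)
    (u : TangentSpace (𝓡 (2 * m - 1)) x) : ∃ ξ v', IsLiftDeriv f N x z v u ξ v' := by
  obtain ⟨ζ, hζ0, hζ, hev, hξ, hξe⟩ := hf.exists_lift hz h0 u
  have hUev : ∀ᶠ t in nhds 0, chartCurve x u t ∈ U :=
    (tendsto_chartCurve x u).eventually (hN.isOpen.mem_nhds hx)
  have hNd := mdifferentiableAt_of_contMDiffOn hN.isOpen hN.smooth hx
  have hJd := mdifferentiableAt_of_contMDiffOn hN.isOpen (contMDiffOn_cplx hf hN) hx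
  have hvd := hasDerivAt_mulVec (hasDerivAt_chartCurve hNd u) hζ
  have hv0 : N (chartCurve x u 0) *ᵥ ζ 0 = v := by
    rw [hζ0, congrArg N (chartCurve_zero x u), hNv, tangentVec_mulVec hz hv.left]
  generalize dirDeriv N x u *ᵥ ζ 0 + N (chartCurve x u 0) *ᵥ (dirDeriv f x u *ᵥ z) = v' at hvd
  set ξ := dirDeriv f x u *ᵥ z with hξdef
  have hlift : ∀ᶠ t in nhds 0, IsUnitVec (ζ t) ∧ f (chartCurve x u t) = point (ζ t) ∧
      IsHorizontal (ζ t) (N (chartCurve x u t) *ᵥ ζ t) ∧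
      IsUnitVec (N (chartCurve x u t) *ᵥ ζ t) ∧
      N (chartCurve x u t) = tangentVec (ζ t) (N (chartCurve x u t) *ᵥ ζ t) := by
    filter_upwards [hev, hUev] with t ht htU
    obtain ⟨a, ha, ha1, hNa, -, -⟩ := hN.exists_rep htU ht.1 ht.2.2
    rw [hNa, tangentVec_mulVec ht.1 ha.left]
    exact ⟨ht.1, ht.2.2, ha, ha1, rfl⟩
  refine ⟨ξ, v', hξ, hξe, ?_, ?_, ?_, ?_, ?_, ?_, ?_⟩
  · have h := hasDerivAt_tangentVec hζ hvd
    rw [hv0, hζ0] at h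
    exact hasDerivAt_eq_of_eventuallyEq (hasDerivAt_chartCurve hNd u) h
      (hlift.mono fun t ht => ht.2.2.2.2)
  · have h := hasDerivAt_tangentVec hζ (hvd.fun_const_smul Complex.I)
    rw [hv0, hζ0] at h
    refine hasDerivAt_eq_of_eventuallyEq (hasDerivAt_chartCurve hJd u) h ?_
    filter_upwards [hlift] with t ht
    rw [ht.2.1]
    conv_lhs => rw [ht.2.2.2.2]
    exact cplx_tangentVec ht.1 ht.2.2.1.left
  · exact ComplexQuadric.nablaBar_eq hN.isOpen hx hN.tangent hNd hz hq h0 hζ0 hζ hξ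
      (hlift.mono fun t ht => ht.2.1) hvd
  · have h := hasDerivAt_eq_of_eventuallyEq (hasDerivAt_dot (hasDerivAt_star_vec hζ) hvd)
      (hasDerivAt_const 0 (0 : ℂ)) (hlift.mono fun t ht => ht.2.2.1.left)
    rw [hv0, hζ0] at h
    exact eq_neg_of_add_eq_zero_right h
  · have h := hasDerivAt_eq_of_eventuallyEq (hasDerivAt_dot hζ hvd)
      (hasDerivAt_const 0 (0 : ℂ)) (hlift.mono fun t ht => ht.2.2.1.right)
    rw [hv0, hζ0] at h
    exact eq_neg_of_add_eq_zero_right h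
  · have h := hasDerivAt_eq_of_eventuallyEq (hasDerivAt_dot (hasDerivAt_star_vec hvd) hvd)
      (hasDerivAt_const 0 (1 : ℂ)) (hlift.mono fun t ht => ht.2.2.2.1)
    rw [hv0, ← star_dot_swap] at h
    have h' := congrArg Complex.re h
    simp only [Complex.add_re, Complex.star_def, Complex.conj_re, Complex.zero_re] at h'
    linarith
  · intro hc
    have h1 := (hasDerivAt_dot hvd hvd).fun_smul (hasDerivAt_star_vec hvd)
    have h2 := hasDerivAt_eq_of_eventuallyEq hvd h1 (by
      filter_upwards [hlift, (tendsto_chartCurve x u).eventually hc] with t ht htc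
      exact htc _ _ ht.1 ht.2.1 ht.2.2.1 ht.2.2.2.2)
    rw [hv0, dotProduct_comm v' v, ← two_mul] at h2
    exact h2

/-- The real part vanishes because |v| = 1, the imaginary part because ⟨dN(a), JN⟩ = 0. -/
theorem star_dot_deriv_normal {f N : M → Mat m} {U : Set M}
    (hω : ∀ y ∈ U, ∀ a : TangentSpace (𝓡 (2 * m - 1)) y,
      metric (dirDeriv N y a) (cplx (f y) (N y)) = 0) {x : M} (hx : x ∈ U)
    {z v : Fin (m + 2) → ℂ} (hz : IsUnitVec z) (h0 : f x = point z) (hv : IsHorizontal z v)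
    (hv1 : IsUnitVec v) (hNv : N x = tangentVec z v)
    {a : TangentSpace (𝓡 (2 * m - 1)) x} {ξ v' : Fin (m + 2) → ℂ}
    (ha : IsLiftDeriv f N x z v a ξ v') : star v ⬝ᵥ v' = 0 := by
  have h := hω x hx a
  have e0 : tangentVec (0 : Fin (m + 2) → ℂ) (Complex.I • v) = 0 := by simp [tangentVec]
  rw [ha.dirDeriv_normal, h0, hNv, cplx_tangentVec hz hv.left,
    ← add_zero (tangentVec z (Complex.I • v)), ← e0,
    metric_tangentVec_add hz hv.left hv1 ha.horizontal.left (dotProduct_zero _), hv.left] at h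
  simp only [mul_zero, star_zero, zero_dotProduct, dotProduct_zero, Complex.zero_im] at h
  refine Complex.ext ha.re_star_dot ?_
  rw [← star_dot_swap]
  simp only [Complex.star_def, Complex.conj_im, Complex.zero_im]
  linarith

section

variable [IsManifold (𝓡 (2 * m - 1)) ∞ M] {f N : M → Mat m} {U : Set M}

theorem im_star_dot_eq (hf : IsRealHypersurface f) (hN : IsUnitNormal f U N)
    (hω : ∀ y ∈ U, ∀ a : TangentSpace (𝓡 (2 * m - 1)) y,
      metric (dirDeriv N y a) (cplx (f y) (N y)) = 0) {x : M} (hx : x ∈ U)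
    {z v : Fin (m + 2) → ℂ} (hz : IsUnitVec z) (hv : IsHorizontal z v) (hv1 : IsUnitVec v)
    {a b : TangentSpace (𝓡 (2 * m - 1)) x} {ξ₁ v₁ ξ₂ v₂ : Fin (m + 2) → ℂ}
    (ha : IsLiftDeriv f N x z v a ξ₁ v₁) (hb : IsLiftDeriv f N x z v b ξ₂ v₂) :
    (star v₁ ⬝ᵥ v₂).im = (star ξ₁ ⬝ᵥ ξ₂).im := by
  have h := metric_dirDeriv_symm hN.isOpen hN.smooth (contMDiffOn_cplx hf hN) hω hx a b
  rw [ha.dirDeriv_normal, hb.dirDeriv_normal, ha.dirDeriv_cplx, hb.dirDeriv_cplx,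
    metric_tangentVec_add hz hv.left hv1 ha.horizontal.left hb.horizontal.left,
    metric_tangentVec_add hz hv.left hv1 hb.horizontal.left ha.horizontal.left,
    ← star_dot_swap v₁ v₂, ← star_dot_swap ξ₁ ξ₂, mul_comm (star z ⬝ᵥ v₂),
    mul_comm (star ξ₂ ⬝ᵥ v)] at h
  simp only [Complex.star_def, Complex.conj_im] at h
  linarith

/-- If `S ξ = 0` near `x`, then the unit normal is isotropic or principal. -/
theorem eq_dot_smul_star (hf : IsRealHypersurface f) (hN : IsUnitNormal f U N)
    (hS : ∀ y ∈ U, ∀ u : TangentSpace (𝓡 (2 * m - 1)) y, dirDeriv f y u = reeb f N y →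
      nablaBar f N y u = 0) {x : M} (hx : x ∈ U)
    {z v : Fin (m + 2) → ℂ} (hz : IsUnitVec z) (hq : OnQuadric z) (h0 : f x = point z)
    (hv : IsHorizontal z v) (hNv : N x = tangentVec z v) (hvv : v ⬝ᵥ v ≠ 0) :
    v = (v ⬝ᵥ v) • star v ∧ star (v ⬝ᵥ v) * (v ⬝ᵥ v) = 1 := by
  have hω : ∀ y ∈ U, ∀ a : TangentSpace (𝓡 (2 * m - 1)) y,
      metric (dirDeriv N y a) (cplx (f y) (N y)) = 0 := by
    intro y hy a
    obtain ⟨u, hu⟩ := hf.exists_reeb hN hy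
    exact metric_dirDeriv_normal_cplx hf hN hy hu (hS y hy u hu) a
  have hNu := hN.unit x hx
  rw [hNv, metric_tangentVec hz hv.left hv.left] at hNu
  have hv1 : IsUnitVec v := Complex.ext hNu (by simpa using star_dot_self_im v)
  have hv1' : star v ⬝ᵥ v = 1 := hv1
  have hv1'' : v ⬝ᵥ star v = 1 := by rw [dotProduct_comm, hv1']
  have hss : star v ⬝ᵥ star v = star (v ⬝ᵥ v) := Matrix.star_dotProduct_star v v
  set h := v ⬝ᵥ v with hh
  have hreeb : reeb f N x = tangentVec z (-(Complex.I • v)) := by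
    rw [reeb, h0, hNv, cplx_tangentVec hz hv.left, tangentVec_neg]
  obtain ⟨u, hu⟩ := hf.exists_reeb hN hx
  obtain ⟨ξ₁, v₁, hd₁⟩ := exists_isLiftDeriv hf hN hx hz hq h0 hv hNv u
  have hξ₁ : ξ₁ = -(Complex.I • v) := by
    refine tangentVec_injective hz hd₁.horizontal (by simpa using hv.smul (-Complex.I)) ?_
    rw [← hd₁.dirDeriv_eq, hu, hreeb]
  have hv₁0 : hor z v₁ = 0 := by
    have h1 := hS x hx u hu
    rw [hd₁.nablaBar_eq, ← tangentVec_zero z] at h1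
    exact tangentVec_injective hz (hor_isHorizontal hz hq _) ⟨dotProduct_zero _, dotProduct_zero _⟩
      h1
  -- Sξ = 0 kills the horizontal part; the components along z and z̄ come from differentiating ⟨z,v⟩
  -- = 0 and z·v = 0.
  have hv₁ : v₁ = -Complex.I • z + (Complex.I * h) • star z := by
    have e1 := hd₁.star_dot_left
    have e2 := hd₁.dot_left
    rw [hξ₁] at e1 e2
    rw [hor, sub_sub, sub_eq_zero] at hv₁0
    rw [hv₁0, e1, e2]
    simp [hv1', ← hh]
  -- This is `im_star_dot_eq` for the Reeb direction and the direction with lift w.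
  have key : ∀ w, IsHorizontal z w → (star v ⬝ᵥ w).re = 0 → (star h * (w ⬝ᵥ v)).re = 0 := by
    intro w hw hvw
    obtain ⟨a, ha⟩ := hf.exists_dirDeriv_eq hz hq h0 hv hv1
      (fun u => by rw [← hNv]; exact hN.normal x hx u) hw hvw
    obtain ⟨ξ₂, v₂, hd₂⟩ := exists_isLiftDeriv hf hN hx hz hq h0 hv hNv a
    have hξ₂ : ξ₂ = w := by
      refine tangentVec_injective hz hd₂.horizontal hw ?_
      rw [← hd₂.dirDeriv_eq, ha]
    have h1 := im_star_dot_eq hf hN hω hx hz hv hv1 hd₁ hd₂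
    have e1 := hd₂.star_dot_left
    have e2 := hd₂.dot_left
    rw [hξ₂, ← star_dot_swap v w] at e1
    rw [hξ₂] at e2
    rw [hv₁, hξ₁, hξ₂] at h1
    simp only [star_add, star_smul, star_neg, star_star, add_dotProduct, smul_dotProduct,
      neg_dotProduct, e1, e2] at h1
    generalize star v ⬝ᵥ w = c at *
    generalize w ⬝ᵥ v = d at *
    simp [hvw] at h1 ⊢
    linarith
  -- The test vector is the part of h v̄ orthogonal to v; it yields |h|²(1 - |h|²) = 0.
  have h2 := key (h • star v - (star h * h) • v) ((hv.conj.smul _).sub (hv.smul _)) (by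
    rw [dotProduct_sub, dotProduct_smul, dotProduct_smul, hss, hv1']
    simp)
  rw [sub_dotProduct, smul_dotProduct, smul_dotProduct, hv1', ← hh] at h2
  have hn : star h * h = ((Complex.normSq h : ℝ) : ℂ) := by
    rw [Complex.star_def, mul_comm, Complex.mul_conj]
  have h3 : Complex.normSq h = 1 := by
    have e : star h * (h • (1 : ℂ) - (star h * h) • h) =
        ((Complex.normSq h * (1 - Complex.normSq h) : ℝ) : ℂ) := by
      push_cast
      rw [← hn, smul_eq_mul, smul_eq_mul]
      ring
    rw [e, Complex.ofReal_re] at h2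
    have h4 : Complex.normSq h ≠ 0 := by simpa using hvv
    have h5 := (mul_eq_zero.1 h2).resolve_left h4
    linarith
  rw [h3, Complex.ofReal_one] at hn
  refine ⟨?_, hn⟩
  -- Equality case of Cauchy–Schwarz: |v - h v̄|² = 1 - |h|².
  have h6 : v - h • star v = 0 := by
    apply eq_zero_of_star_dot
    rw [star_sub, star_smul, star_star]
    simp only [sub_dotProduct, dotProduct_sub, smul_dotProduct, dotProduct_smul, hv1', hv1'', hss,
      ← hh, smul_eq_mul]
    linear_combination -hn
  exact sub_eq_zero.1 h6

/-- The unit normal of a Hopf hypersurface with `S ξ = 0` is isotropic. -/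
theorem dot_self_eq_zero_of_nablaBar_reeb (hm : 3 ≤ m) (hf : IsRealHypersurface f)
    (hN : IsUnitNormal f U N)
    (hS : ∀ y ∈ U, ∀ u : TangentSpace (𝓡 (2 * m - 1)) y, dirDeriv f y u = reeb f N y →
      nablaBar f N y u = 0)
    (hU : ∀ y ∈ U, ∀ z v, IsUnitVec z → f y = point z → IsHorizontal z v →
      N y = tangentVec z v → v ⬝ᵥ v ≠ 0) (x : M) : x ∉ U := by
  intro hx
  obtain ⟨z, hz, hq, h0⟩ := hf.exists_rep x
  obtain ⟨v, hv, hv1, hNv, -, hn⟩ := hN.exists_rep hx hz h0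
  have hv1' : star v ⬝ᵥ v = 1 := hv1
  have hω : ∀ y ∈ U, ∀ a : TangentSpace (𝓡 (2 * m - 1)) y,
      metric (dirDeriv N y a) (cplx (f y) (N y)) = 0 := by
    intro y hy a
    obtain ⟨u, hu⟩ := hf.exists_reeb hN hy
    exact metric_dirDeriv_normal_cplx hf hN hy hu (hS y hy u hu) a
  have hconj : ∀ᶠ y in nhds x, ∀ z v, IsUnitVec z → f y = point z → IsHorizontal z v →
      N y = tangentVec z v → v = (v ⬝ᵥ v) • star v := by
    filter_upwards [hN.isOpen.mem_nhds hx] with y hy z v hz h0 hv hNv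
    have hq : OnQuadric z := onQuadric_of_point_mem hz (h0 ▸ hf.mem y)
    exact (eq_dot_smul_star hf hN hS hy hz hq h0 hv hNv (hU y hy z v hz h0 hv hNv)).1
  obtain ⟨hvh, hh1⟩ := eq_dot_smul_star hf hN hS hx hz hq h0 hv hNv (hU x hx z v hz h0 hv hNv)
  -- Differentiating v = (v·v)v̄ leaves the derivative of v·v, namely 2 v·v' = 2(v·v)⟨v,v'⟩ = 0.
  have hderiv : ∀ {a : TangentSpace (𝓡 (2 * m - 1)) x} {ξ v' : Fin (m + 2) → ℂ},
      IsLiftDeriv f N x z v a ξ v' → v' = (v ⬝ᵥ v) • star v' := by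
    intro a ξ v' hd
    have h1 := star_dot_deriv_normal hω hx hz h0 hv hv1 hNv hd
    have h2 : v ⬝ᵥ v' = 0 := by
      rw [hvh, smul_dotProduct, h1, smul_zero]
    have h3 := hd.deriv_conj hconj
    rwa [h2, mul_zero, zero_smul, add_zero] at h3
  obtain ⟨w, hw0, hw, hvw, -⟩ := exists_horizontal_orthogonal hm z v
  obtain ⟨a, ha⟩ := hf.exists_dirDeriv_eq hz hq h0 hv hv1 hn hw (by rw [hvw, Complex.zero_re])
  obtain ⟨b, hb⟩ := hf.exists_dirDeriv_eq hz hq h0 hv hv1 hn (hw.smul Complex.I)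
    (by rw [dotProduct_smul, hvw, smul_zero, Complex.zero_re])
  obtain ⟨ξ₁, v₁, hd₁⟩ := exists_isLiftDeriv hf hN hx hz hq h0 hv hNv a
  obtain ⟨ξ₂, v₂, hd₂⟩ := exists_isLiftDeriv hf hN hx hz hq h0 hv hNv b
  have hξ₁ : ξ₁ = w :=
    tangentVec_injective hz hd₁.horizontal hw (by rw [← hd₁.dirDeriv_eq, ha])
  have hξ₂ : ξ₂ = Complex.I • w :=
    tangentVec_injective hz hd₂.horizontal (hw.smul _) (by rw [← hd₂.dirDeriv_eq, hb])
  have h1 := im_star_dot_eq hf hN hω hx hz hv hv1 hd₁ hd₂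
  -- Both vectors are fixed by the conjugation a ↦ h ā with |h| = 1, so their Hermitian product is
  -- real.
  have h2 : star (star v₁ ⬝ᵥ v₂) = star v₁ ⬝ᵥ v₂ := by
    have e1 := hderiv hd₁
    have e2 := hderiv hd₂
    have e : star v₁ ⬝ᵥ v₂ = (star (v ⬝ᵥ v) * (v ⬝ᵥ v)) * (v₁ ⬝ᵥ star v₂) := by
      conv_lhs => rw [e1, e2]
      rw [star_smul, star_star, smul_dotProduct, dotProduct_smul, smul_eq_mul, smul_eq_mul]
      ring
    rw [hh1, one_mul, dot_star_swap] at e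
    exact e.symm
  have h3 := congrArg Complex.im h2
  simp only [Complex.star_def, Complex.conj_im] at h3
  rw [hξ₁, hξ₂, dotProduct_smul, smul_eq_mul, Complex.I_mul_im] at h1
  apply hw0
  apply eq_zero_of_star_dot
  refine Complex.ext ?_ (star_dot_self_im w)
  rw [← h1, Complex.zero_re]
  linarith

end

/-- The tangent field obtained by projecting a constant matrix. -/
theorem isTangentField_proj {f N : M → Mat m} {U : Set M} (hf : IsRealHypersurface f)
    (hN : IsUnitNormal f U N) {H : Mat m} (hH : H.IsHermitian) :
    IsTangentField f U (fun y => projQ (f y) H - metric (projQ (f y) H) (N y) • N y) := by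
  refine ⟨?_, ?_⟩
  · have h1 : ContDiff ℝ ∞ (fun p : Mat m × Mat m => p.1) := contDiff_fst
    have h2 : ContDiff ℝ ∞ (fun p : Mat m × Mat m => p.2) := contDiff_snd
    have h3 := contDiff_sub_metric_smul (contDiff_projQ h1 (contDiff_const (c := H))) h2
    have h4 := h3.contMDiff.comp_contMDiffOn (hf.smooth.contMDiffOn.prodMk_space hN.smooth)
    exact h4
  · intro y hy
    obtain ⟨z, hz, hq, h0⟩ := hf.exists_rep y
    obtain ⟨v, hv, hv1, hNv, -, hn⟩ := hN.exists_rep hy hz h0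
    have hv1' : star v ⬝ᵥ v = 1 := hv1
    obtain ⟨k, hk, hke⟩ := exists_horizontal hz (projQ_mem (h0 ▸ hf.mem y) hH)
    simp only [h0, hke, hNv, metric_tangentVec hz hk.left hv.left, ← tangentVec_smul,
      ← tangentVec_sub]
    refine hf.exists_dirDeriv_eq hz hq h0 hv hv1 hn (hk.sub (hv.smul _)) ?_
    rw [dotProduct_sub, dotProduct_smul, hv1', ← star_dot_swap v k]
    simp

/-! ### Detecting isotropy of the normal without choosing lifts. -/

theorem transpose_mul_self_tangentVec {z v : Fin (m + 2) → ℂ} (hq : OnQuadric z)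
    (hv : IsHorizontal z v) :
    (tangentVec z v)ᵀ * tangentVec z v = (v ⬝ᵥ v) • Matrix.vecMulVec (star z) (star z) := by
  simp [tangentVec, Matrix.transpose_vecMulVec, add_mul, mul_add, Matrix.vecMulVec_mul_vecMulVec,
    Matrix.vecMulVec_smul, hv.right, dotProduct_comm v z, hq.dot]

theorem transpose_mul_self_ne_zero_iff {z v : Fin (m + 2) → ℂ} (hz : IsUnitVec z)
    (hq : OnQuadric z) (hv : IsHorizontal z v) :
    (tangentVec z v)ᵀ * tangentVec z v ≠ 0 ↔ v ⬝ᵥ v ≠ 0 := by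
  rw [transpose_mul_self_tangentVec hq hv, Ne, smul_eq_zero, not_or]
  refine ⟨fun h => h.1, fun h => ⟨h, fun h0 => ?_⟩⟩
  have h1 := congrArg (fun A : Mat m => A *ᵥ z) h0
  have hz' : star z ⬝ᵥ z = 1 := hz
  rw [Matrix.vecMulVec_mulVec, hz', Matrix.zero_mulVec, MulOpposite.op_one, one_smul,
    star_eq_zero] at h1
  rw [h1] at hz'
  simp at hz'

theorem isIsotropic_normal_iff {f N : M → Mat m} {U : Set M} (hN : IsUnitNormal f U N) {x : M}
    (hx : x ∈ U) {z v : Fin (m + 2) → ℂ} (hz : IsUnitVec z) (hq : OnQuadric z)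
    (h0 : f x = point z) (hv : IsHorizontal z v) (hNv : N x = tangentVec z v) :
    IsIsotropic (f x) (N x) ↔ v ⬝ᵥ v = 0 := by
  have h1 := hN.unit x hx
  rw [hNv, metric_tangentVec hz hv.left hv.left] at h1
  rw [h0, hNv]
  exact isIsotropic_iff hz hq hv (Complex.ext h1 (by simpa using star_dot_self_im v))

/-! ### The two implications. -/

theorem HasIsotropicNormal.hasReebParallelNormalJacobi {f : M → Mat m} (hf : IsRealHypersurface f)
    (hHopf : IsHopf f) (h : HasIsotropicNormal f) : HasReebParallelNormalJacobi f := by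
  intro U N Y hN hY x hx u hu
  obtain ⟨z, hz, hq, h0⟩ := hf.exists_rep x
  obtain ⟨v, hv, hv1, hNv, -, -⟩ := hN.exists_rep hx hz h0
  have hYt := hY.mem hf hx
  rw [h0] at hYt
  obtain ⟨w, hw, hYw⟩ := exists_horizontal hz hYt
  obtain ⟨α, hα⟩ := hHopf U N hN x hx u hu
  have hvv := (isIsotropic_normal_iff hN hx hz hq h0 hv hNv).1 (h U N hN x hx)
  rw [nablaNormalJacobi_eq hf hN hY hx hz hq h0 hv hv1 hNv hw hYw hα, hvv]
  simp [tangentVec_zero]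

theorem HasReebParallelNormalJacobi.mul_dot_self_eq_zero {f : M → Mat m} (hm : 3 ≤ m)
    (hf : IsRealHypersurface f) (h : HasReebParallelNormalJacobi f) {U : Set M} {N : M → Mat m}
    (hN : IsUnitNormal f U N) {x : M} (hx : x ∈ U) {z v : Fin (m + 2) → ℂ} (hz : IsUnitVec z)
    (hq : OnQuadric z) (h0 : f x = point z) (hv : IsHorizontal z v) (hv1 : IsUnitVec v)
    (hNv : N x = tangentVec z v) {u : TangentSpace (𝓡 (2 * m - 1)) x}
    (hu : dirDeriv f x u = reeb f N x) {α : ℝ} (hα : shape f N x u = α • reeb f N x) :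
    (α : ℂ) * (v ⬝ᵥ v) = 0 := by
  obtain ⟨w, hw0, hw, hvw, hvw'⟩ := exists_horizontal_orthogonal hm z v
  -- The condition concerns vector fields, so w is extended to a tangent field with that value at x.
  -- As v·w = 0, the normal correction in the formula vanishes.
  have hY := isTangentField_proj hf hN (tangentVec_isHermitian z w)
  have hYx : projQ (f x) (tangentVec z w) - metric (projQ (f x) (tangentVec z w)) (N x) • N x =
      tangentVec z w := by
    rw [h0, projQ_of_mem (tangentVec_mem hz hq hw), hNv, metric_comm,
      metric_tangentVec hz hv.left hw.left, hvw, Complex.zero_re, zero_smul, sub_zero]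
  have h1 := h U N _ hN hY x hx u hu
  rw [nablaNormalJacobi_eq hf hN hY hx hz hq h0 hv hv1 hNv hw hYx hα, star_smul, star_star,
    smul_dotProduct, dotProduct_comm w v, hvw', smul_zero, Complex.zero_re, Complex.ofReal_zero,
    zero_smul, sub_zero, ← tangentVec_zero z] at h1
  have h2 := tangentVec_injective hz (hw.conj.smul _) ⟨dotProduct_zero _, dotProduct_zero _⟩ h1
  have h3 := (smul_eq_zero.1 h2).resolve_right (by simpa using hw0)
  have h4 : 2 * Complex.I * ((α : ℂ) * (v ⬝ᵥ v)) = 0 := by rw [← h3]; ring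
  exact (mul_eq_zero.1 h4).resolve_left (by simp)

theorem HasReebParallelNormalJacobi.hasIsotropicNormal [IsManifold (𝓡 (2 * m - 1)) ∞ M]
    {f : M → Mat m} (hm : 3 ≤ m) (hf : IsRealHypersurface f) (hHopf : IsHopf f)
    (h : HasReebParallelNormalJacobi f) : HasIsotropicNormal f := by
  intro U N hN x hx
  by_contra hiso
  -- This is the set where v·v ≠ 0, written through the matrix NᵀN so that continuity of N shows it
  -- is open.
  let V : Set M := {y ∈ U | (N y)ᵀ * N y ≠ 0}
  have hV : IsOpen V := by
    have hc : Continuous (fun A : Mat m => Aᵀ * A) := by fun_prop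
    exact (hc.comp_continuousOn hN.smooth.continuousOn).isOpen_inter_preimage hN.isOpen
      isOpen_compl_singleton
  have hVU : V ⊆ U := fun y hy => hy.1
  have hNV := hN.mono hV hVU
  have hne : ∀ y ∈ V, ∀ z v, IsUnitVec z → f y = point z → IsHorizontal z v →
      N y = tangentVec z v → v ⬝ᵥ v ≠ 0 := by
    intro y hy z v hz h0 hv hNv
    have h1 := hy.2
    rw [hNv] at h1
    exact (transpose_mul_self_ne_zero_iff hz (onQuadric_of_point_mem hz (h0 ▸ hf.mem y)) hv).1 h1
  have hS : ∀ y ∈ V, ∀ u : TangentSpace (𝓡 (2 * m - 1)) y, dirDeriv f y u = reeb f N y →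
      nablaBar f N y u = 0 := by
    intro y hy u hu
    obtain ⟨z, hz, hq, h0⟩ := hf.exists_rep y
    obtain ⟨v, hv, hv1, hNv, -, -⟩ := hN.exists_rep hy.1 hz h0
    obtain ⟨α, hα⟩ := hHopf U N hN y hy.1 u hu
    have h1 := h.mul_dot_self_eq_zero hm hf hN hy.1 hz hq h0 hv hv1 hNv hu hα
    have h2 : (α : ℂ) = 0 := (mul_eq_zero.1 h1).resolve_right (hne y hy z v hz h0 hv hNv)
    rw [Complex.ofReal_eq_zero.1 h2, zero_smul, shape, neg_eq_zero] at hα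
    exact hα
  refine dot_self_eq_zero_of_nablaBar_reeb hm hf hNV hS hne x ⟨hx, ?_⟩
  obtain ⟨z, hz, hq, h0⟩ := hf.exists_rep x
  obtain ⟨v, hv, hv1, hNv, -, -⟩ := hN.exists_rep hx hz h0
  rw [isIsotropic_normal_iff hN hx hz hq h0 hv hNv] at hiso
  rw [hNv]
  exact (transpose_mul_self_ne_zero_iff hz hq hv).2 hiso

end Manifold

end ComplexQuadric

end

open ComplexQuadric in
theorem theorem2 (m : ℕ) (hm : 3 ≤ m) {M : Type*} [TopologicalSpace M]
    [ChartedSpace (EuclideanSpace ℝ (Fin (2 * m - 1))) M] [IsManifold (𝓡 (2 * m - 1)) ∞ M]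
    (f : M → Mat m) (hf : IsRealHypersurface f) (hHopf : IsHopf f) :
    HasIsotropicNormal f ↔ HasReebParallelNormalJacobi f := by
  exact ⟨fun h => h.hasReebParallelNormalJacobi hf hHopf,
    fun h => h.hasIsotropicNormal hm hf hHopf⟩
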